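/- Let $A_1,\dots,A_n\in\mathbb{R}^d$ ($n\ge 1$), $A=[A_1,\dots,A_n]$ with spectral norm $\|A\|_2$, $R\ge\max_i\|A_i\|_2$, and $\lambda,\gamma,\epsilon>0$. Let each $\phi_i:\mathbb{R}\to\mathbb{R}$ be convex and differentiable with $1/\gamma$-Lipschitz derivative, and let $g:\mathbb{R}^d\to\mathbb{R}$ be $1$-strongly convex (with respect to the Euclidean norm). With ${}^*$ denoting the convex conjugate, put \[ P(w)=\frac1n\sum_{i=1}^n\phi_i(A_i^Tw)+\lambda g(w),\qquad D(x)=\frac1n\sum_{i=1}^n-\phi_i^*(-x_i)-\lambda g^*\Bigl(\frac{1}{\lambda n}Ax\Bigr). \] Let $x^{(0)}\in\mathbb{R}^n$ satisfy $D(x^{(0)})>-\infty$. Let $x^{(k)}$ be generated by the APCG method, started with $z^{(0)}=x^{(0)}$, applied to $-D=f+\sum_i\Psi_i$ with \[ f(x)=\lambda g^*\Bigl(\frac{1}{\lambda n}Ax\Bigr)+\frac{\gamma}{2n}\|x\|_2^2,\qquad \Psi_i(t)=\frac1n\Bigl(\phi_i^*(-t)-\frac{\gamma}{2}t^2\Bigr),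 \] $L_i=\frac{\|A_i\|_2^2}{\lambda n^2}+\frac{\gamma}{n}$, $\|x\|_L^2=\sum_iL_ix_i^2$, $\mu=\frac{\lambda\gamma n}{R^2+\lambda\gamma n}$ and $\alpha=\frac{\sqrt\mu}{n}$; that is, for $k=0,1,\dots$, with $i_k$ drawn independently and uniformly from $\{1,\dots,n\}$, \[ y^{(k)}=\frac{x^{(k)}+\alpha z^{(k)}}{1+\alpha},\qquad z^{(k+1)}=\arg\min_{u\in\mathbb{R}^n}\Bigl\{\frac{n\alpha}{2}\bigl\|u-(1-\alpha)z^{(k)}-\alpha y^{(k)}\bigr\|_L^2+\nabla_{i_k}f(y^{(k)})\,(u_{i_k}-y^{(k)}_{i_k})+\Psi_{i_k}(u_{i_k})\Bigr\}, \] \[ x^{(k+1)}=y^{(k)}+n\alpha\,(z^{(k+1)}-z^{(k)})+n\alpha^2\,(z^{(k)}-y^{(k)}). \] For $x\in\mathbb{R}^n$ let the proximal full gradient step be \[ T(x)=\arg\min_{u\in\mathbb{R}^n}\Bigl\{\langle\nabla f_0(x),u\rangle+\frac{\|A\|_2^2}{2\lambda n^2}\|u-x\|_2^2+\frac1n\sum_{i=1}^n\phi_i^*(-u_i)\Bigr\},\qquad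 f_0(x)=\lambda g^*\Bigl(\frac{1}{\lambda n}Ax\Bigr), \] and put $w^{(k)}=\nabla g^*\bigl(\frac{1}{\lambda n}A\,T(x^{(k)})\bigr)$. Then $g^*$ is finite and differentiable, all the minimizers above exist and are unique, and $D$ has a unique maximizer $x^\star$. With $D^\star=D(x^\star)$ and $C=D^\star-D(x^{(0)})+\frac{\gamma}{2n}\|x^{(0)}-x^\star\|_2^2$, for every integer $k\ge0$ with \[ k\ \ge\ \Bigl(n+\sqrt{\frac{nR^2}{\lambda\gamma}}\Bigr)\log\Bigl(\frac{4\|A\|_2^2}{\lambda\gamma n}\cdot\frac{C}{\epsilon}\Bigr) \] the gap $P(w^{(k)})-D(T(x^{(k)}))$ is finite and integrable, and $\mathbb{E}\bigl[P(w^{(k)})-D(T(x^{(k)}))\bigr]\le\epsilon$. If $AC=0$, so that the logarithm is $\log 0$, this holds for every $k\ge0$. -/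

import Mathlib

open MeasureTheory ProbabilityTheory

noncomputable section

/-- The convex conjugate `h^*(u) = sup_z (⟨z, u⟩ - h(z))`, with values in `[-∞, ∞]`. -/
def convexConj {E : Type*} [NormedAddCommGroup E] [InnerProductSpace ℝ E]
    (h : E → ℝ) (u : E) : EReal :=
  ⨆ z : E, ((inner ℝ z u - h z : ℝ) : EReal)

/-- `x` is a global minimizer of the extended-valued function `Q`. -/
def IsMinimizer {E : Type*} (Q : E → EReal) (x : E) : Prop := ∀ y, Q x ≤ Q y

/-- A global minimizer of `Q` (an arbitrary point if there is none). -/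
def argminOf {E : Type*} [Nonempty E] (Q : E → EReal) : E :=
  Classical.epsilon (IsMinimizer Q)

section APCG

variable {n : ℕ}

/-- `‖x‖_L ^ 2 = ∑ L_i x_i ^ 2`. -/
def sqNormL (L : Fin n → ℝ) (x : EuclideanSpace ℝ (Fin n)) : ℝ := ∑ i, L i * x i ^ 2

/-- `y^{(k)} = (x^{(k)} + α z^{(k)}) / (1 + α)`. -/
def apcgY (α : ℝ) (x z : EuclideanSpace ℝ (Fin n)) : EuclideanSpace ℝ (Fin n) :=
  (1 / (1 + α)) • (x + α • z)

/-- The function minimized in one APCG step, when coordinate `i` has been drawn: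
`u ↦ (nα/2) ‖u - (1-α) z - α y‖_L^2 + ⟨∇_i f(y), u_i - y_i⟩ + Ψ_i(u_i)`. -/
def apcgModel (f : EuclideanSpace ℝ (Fin n) → ℝ) (Ψ : Fin n → ℝ → EReal) (L : Fin n → ℝ)
    (α : ℝ) (i : Fin n) (y z u : EuclideanSpace ℝ (Fin n)) : EReal :=
  ((n * α / 2 * sqNormL L (u - (1 - α) • z - α • y)
      + gradient f y i * (u i - y i) : ℝ) : EReal) + Ψ i (u i)

/-- The APCG method with `γ₀ = μ > 0`, so that `α_k = β_k = α = √μ / n`, for minimizing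
`f(x) + ∑ Ψ_i(x_i)` from `x^{(0)} = z^{(0)} = x0`, along the coordinates `ξ 0, ξ 1, …`;
the value at `k` is the pair `(x^{(k)}, z^{(k)})`. -/
def apcg (f : EuclideanSpace ℝ (Fin n) → ℝ) (Ψ : Fin n → ℝ → EReal) (L : Fin n → ℝ)
    (μ : ℝ) (x0 : EuclideanSpace ℝ (Fin n)) (ξ : ℕ → Fin n) :
    ℕ → EuclideanSpace ℝ (Fin n) × EuclideanSpace ℝ (Fin n)
  | 0 => (x0, x0)
  | k + 1 =>
    let α : ℝ := √μ / n
    let x := (apcg f Ψ L μ x0 ξ k).1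
    let z := (apcg f Ψ L μ x0 ξ k).2
    let y := apcgY α x z
    let z' := argminOf (apcgModel f Ψ L α (ξ k) y z)
    (y + (n * α) • (z' - z) + (n * α ^ 2) • (z - y), z')

end APCG

/-- The data of a regularized empirical risk minimization problem with linear predictors:
vectors `A_i ∈ ℝ^d`, losses `φ_i`, a regularizer `g`, the regularization parameter `λ`, and the
(inverse) smoothness parameter `γ` of the losses. -/
structure ERM (n d : ℕ) where
  A : Fin n → EuclideanSpace ℝ (Fin d)
  φ : Fin n → ℝ → ℝ
  g : EuclideanSpace ℝ (Fin d) → ℝ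
  lam : ℝ
  γ : ℝ

namespace ERM

variable {n d : ℕ} (p : ERM n d)

/-- Each `φ_i` is convex and `1/γ`-smooth, and `g` has convexity parameter `1`. -/
structure Regular : Prop where
  lam_pos : 0 < p.lam
  γ_pos : 0 < p.γ
  φ_convex : ∀ i, ConvexOn ℝ Set.univ (p.φ i)
  φ_diff : ∀ i, Differentiable ℝ (p.φ i)
  φ_smooth : ∀ i a b, |deriv (p.φ i) a - deriv (p.φ i) b| ≤ 1 / p.γ * |a - b|
  g_strong : StrongConvexOn Set.univ 1 p.g

/-- The matrix `A = [A_1, …, A_n]` as a linear map; its operator norm is the spectral norm. -/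
def mat : EuclideanSpace ℝ (Fin n) →L[ℝ] EuclideanSpace ℝ (Fin d) :=
  ∑ i, (EuclideanSpace.proj i : EuclideanSpace ℝ (Fin n) →L[ℝ] ℝ).smulRight (p.A i)

/-- The primal objective `P(w) = (1/n) ∑ φ_i(A_iᵀ w) + λ g(w)`. -/
def primal (w : EuclideanSpace ℝ (Fin d)) : ℝ :=
  1 / n * ∑ i, p.φ i (inner ℝ (p.A i) w) + p.lam * p.g w

/-- The point `(1/(λ n)) A x`. -/
def scaled (x : EuclideanSpace ℝ (Fin n)) : EuclideanSpace ℝ (Fin d) :=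
  (1 / (p.lam * n)) • p.mat x

/-- The dual objective `D(x) = (1/n) ∑ -φ_i^*(-x_i) - λ g^*((1/(λ n)) A x)`. -/
def dual (x : EuclideanSpace ℝ (Fin n)) : EReal :=
  ((1 / n : ℝ) : EReal) * ∑ i, -convexConj (p.φ i) (-(x i))
    - (p.lam : EReal) * convexConj p.g (p.scaled x)

/-- `x` maximizes the dual objective. -/
def IsDualOptimal (x : EuclideanSpace ℝ (Fin n)) : Prop := ∀ y, p.dual y ≤ p.dual x

/-- `g^*` as a real-valued function. -/
def gConj (v : EuclideanSpace ℝ (Fin d)) : ℝ := (convexConj p.g v).toReal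

/-- `ω(x) = ∇g^*((1/(λ n)) A x)`. -/
def omega (x : EuclideanSpace ℝ (Fin n)) : EuclideanSpace ℝ (Fin d) :=
  gradient p.gConj (p.scaled x)

/-- The smooth part in the simple splitting of `-D`: `λ g^*((1/(λ n)) A x)`. -/
def fSimple (x : EuclideanSpace ℝ (Fin n)) : ℝ := p.lam * p.gConj (p.scaled x)

/-- The nonsmooth part in the simple splitting of `-D`: `(1/n) ∑ φ_i^*(-x_i)`. -/
def ΨSimple (x : EuclideanSpace ℝ (Fin n)) : EReal :=
  ((1 / n : ℝ) : EReal) * ∑ i, convexConj (p.φ i) (-(x i))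

/-- The smooth part in the splitting used by APCG:
`λ g^*((1/(λ n)) A x) + (γ/(2n)) ‖x‖^2`. -/
def fSplit (x : EuclideanSpace ℝ (Fin n)) : ℝ :=
  p.fSimple x + p.γ / (2 * n) * ‖x‖ ^ 2

/-- The nonsmooth part, coordinatewise, in the splitting used by APCG:
`Ψ_i(t) = (1/n) (φ_i^*(-t) - (γ/2) t^2)`. -/
def ΨSplit (i : Fin n) (t : ℝ) : EReal :=
  ((1 / n : ℝ) : EReal) * (convexConj (p.φ i) (-t) - ((p.γ / 2 * t ^ 2 : ℝ) : EReal))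

/-- The coordinatewise Lipschitz constants `L_i = ‖A_i‖^2 / (λ n^2) + γ / n`. -/
def Lip (i : Fin n) : ℝ := ‖p.A i‖ ^ 2 / (p.lam * n ^ 2) + p.γ / n

/-- The convexity parameter `μ = λ γ n / (R^2 + λ γ n)` used by APCG. -/
def mu (R : ℝ) : ℝ := p.lam * p.γ * n / (R ^ 2 + p.lam * p.γ * n)

/-- The `k`-th APCG iterate `x^{(k)}` for minimizing `-D`, along the coordinates `ξ`. -/
def iter (R : ℝ) (x0 : EuclideanSpace ℝ (Fin n)) (ξ : ℕ → Fin n) (k : ℕ) :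
    EuclideanSpace ℝ (Fin n) :=
  (apcg p.fSplit p.ΨSplit p.Lip (p.mu R) x0 ξ k).1

/-- The function minimized in the proximal full gradient step at `x`:
`u ↦ ⟨∇f(x), u⟩ + (‖A‖^2 / (2 λ n^2)) ‖u - x‖^2 + Ψ(u)`, in the simple splitting. -/
def fullModel (x u : EuclideanSpace ℝ (Fin n)) : EReal :=
  ((inner ℝ (gradient p.fSimple x) u
      + ‖p.mat‖ ^ 2 / (2 * p.lam * n ^ 2) * ‖u - x‖ ^ 2 : ℝ) : EReal) + p.ΨSimple u

/-- The proximal full gradient step `T(x)`. -/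
def proxStep (x : EuclideanSpace ℝ (Fin n)) : EuclideanSpace ℝ (Fin n) :=
  argminOf (p.fullModel x)

/-- `C = D^⋆ - D(x0) + (γ/(2n)) ‖x0 - x^⋆‖^2`, for a dual optimal point `x^⋆`. -/
def constC (x0 xs : EuclideanSpace ℝ (Fin n)) : ℝ :=
  (p.dual xs).toReal - (p.dual x0).toReal + p.γ / (2 * n) * ‖x0 - xs‖ ^ 2

end ERM

end

/-! The proof has two halves: a deterministic bound of the primal-dual gap after a full proximal
step by the dual suboptimality before it, and linear convergence of APCG on the dual.

Gap bound. Write K = ‖A‖²/(λn²), T = T(x), and f₀ for the smooth part λg^*(Ax/(λn)). Strong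
convexity of g makes g^* finite with a 1-Lipschitz gradient, so ∇f₀ is K-Lipschitz. With w =
∇g^*(AT/(λn)), the gap at T is the average of the Fenchel gaps φ_i(b_i) + φ_i^*(-T_i) + T_i b_i,
where b_i = A_iᵀw = n∇_i f₀(T). Optimality of T says T_i = -φ_i'(a_i) with a_i = n(∇_i f₀(x) + K(T_i
- x_i)). Each Fenchel gap is therefore a Bregman distance of φ_i, at most (b_i - a_i)²/(2γ).
Summing, the gap is at most (n/(2γ))(2K‖T - x‖)², while descent of the proximal step gives (K/2)‖T -
x‖² ≤ D^⋆ - D(x). The product of the constants is 4‖A‖²/(λγn) (`ERM.gap_proxStep_le`).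

APCG. Moving (γ/2n)‖x‖² into f makes f μ-strongly convex in ‖·‖_L, and Ψ_i stays convex because φ_i
is 1/γ-smooth. The potential f(x) + ∑ψ_i - F(x^⋆) + (μ/2)‖z - x^⋆‖_L², where F = f + ∑Ψ_i, contracts
in expectation by 1 - α at each step (`apcg_expected_decrease`). Here ψ_i is a surrogate for
Ψ_i(x_i): x is a convex combination of past points z, and ψ_i is the same combination of the values
of Ψ_i. It dominates Ψ_i(x_i) and, unlike it, obeys an exact linear recursion. The initial potential
is at most C, and 1/α ≤ n + √(nR²/(λγ)), which gives the stated number of steps. -/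

theorem EReal.coe_add_le_coe_iff (q a : ℝ) (x : EReal) :
    (q : EReal) + x ≤ a ↔ x ≤ ((a - q : ℝ) : EReal) := by
  induction x with
  | bot => simp
  | top => simpa using (EReal.coe_ne_top (a - q))
  | coe x =>
    rw [← EReal.coe_add, EReal.coe_le_coe_iff, EReal.coe_le_coe_iff, le_sub_iff_add_le']

theorem EReal.exists_coe_of_ne {x : EReal} (hb : x ≠ ⊥) (ht : x ≠ ⊤) : ∃ r : ℝ, x = r :=
  ⟨x.toReal, (EReal.coe_toReal ht hb).symm⟩

theorem lowerSemicontinuous_coe_add {E : Type*} [TopologicalSpace E]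
    {q : E → ℝ} (hq : Continuous q) {Φ : E → EReal}
    (hΦ : LowerSemicontinuous Φ) : LowerSemicontinuous fun u => (q u : EReal) + Φ u := by
  refine LowerSemicontinuous.add' (continuous_coe_real_ereal.comp hq).lowerSemicontinuous hΦ ?_
  intro x
  exact EReal.continuousAt_add (Or.inl (EReal.coe_ne_top _)) (Or.inl (EReal.coe_ne_bot _))

theorem argminOf_eq {E : Type*} [Nonempty E] {Q : E → EReal} {u : E}
    (h : ∃! u, IsMinimizer Q u) (hu : IsMinimizer Q u) : argminOf Q = u :=
  h.unique (Classical.epsilon_spec h.exists) hu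

/-! ### Minimizers of strongly convex extended-valued functions -/

section Minimizers

variable {E : Type*} [NormedAddCommGroup E] [InnerProductSpace ℝ E]

/-- Strong convexity, with modulus `c`, of an extended-valued function. -/
def StrongConvexE (c : ℝ) (Q : E → EReal) : Prop :=
  ∀ ⦃u v : E⦄ ⦃a b θ : ℝ⦄, 0 ≤ θ → θ ≤ 1 → Q u ≤ a → Q v ≤ b →
    Q ((1 - θ) • u + θ • v) ≤
      (((1 - θ) * a + θ * b - c / 2 * (θ * (1 - θ)) * ‖u - v‖ ^ 2 : ℝ) : EReal)

/-- `G` is a field of subgradients of `q`, with modulus `c` of strong convexity. -/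
def HasSupport (c : ℝ) (q : E → ℝ) (G : E → E) : Prop :=
  ∀ y x, q y + inner ℝ (G y) (x - y) + c / 2 * ‖x - y‖ ^ 2 ≤ q x

/-- Proper closed convex extended-valued functions. -/
structure ProperClosedConvex (Φ : E → EReal) : Prop where
  lsc : LowerSemicontinuous Φ
  convex : StrongConvexE 0 Φ
  proper : ∃ u, Φ u ≠ ⊤
  minorant : ∃ B a : ℝ, ∀ u, ((-B * ‖u‖ + a : ℝ) : EReal) ≤ Φ u

/-- Compare Q at the minimizer with Q at a point of the segment towards `v`, divide by the parameter
θ, and let θ tend to 0. This quadratic growth replaces subgradient optimality conditions everywhere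
below. -/
theorem StrongConvexE.growth {c : ℝ} {Q : E → EReal} (hQ : StrongConvexE c Q) {u v : E}
    (hu : IsMinimizer Q u) {m b : ℝ} (hm : Q u = m) (hv : Q v ≤ b) :
    m + c / 2 * ‖v - u‖ ^ 2 ≤ b := by
  have key : ∀ θ : ℝ, θ ∈ Set.Ioo (0 : ℝ) 1 → m + c / 2 * (1 - θ) * ‖v - u‖ ^ 2 ≤ b := by
    rintro θ ⟨h0, h1⟩
    have h := (hu _).trans (hQ h0.le h1.le hm.le hv)
    rw [hm, EReal.coe_le_coe_iff, norm_sub_rev] at h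
    have : 0 ≤ θ * (b - m - c / 2 * (1 - θ) * ‖v - u‖ ^ 2) := by linarith
    have := nonneg_of_mul_nonneg_right this h0
    linarith
  have hlim : Filter.Tendsto (fun θ : ℝ => m + c / 2 * (1 - θ) * ‖v - u‖ ^ 2)
      (nhdsWithin 0 (Set.Ioi 0)) (nhds (m + c / 2 * (1 - 0) * ‖v - u‖ ^ 2)) :=
    Filter.Tendsto.mono_left (Continuous.tendsto (by fun_prop) 0) nhdsWithin_le_nhds
  have := le_of_tendsto hlim
    (Filter.mem_of_superset (Ioo_mem_nhdsGT (zero_lt_one' ℝ)) key)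
  simpa using this

theorem StrongConvexE.unique {c : ℝ} (hc : 0 < c) {Q : E → EReal} (hQ : StrongConvexE c Q)
    {u v : E} (hu : IsMinimizer Q u) (hv : IsMinimizer Q v) {m : ℝ} (hm : Q u = m) : v = u := by
  have h := hQ.growth hu hm ((hv u).trans hm.le)
  have : ‖v - u‖ ^ 2 ≤ 0 := by nlinarith
  rw [← sub_eq_zero, ← norm_eq_zero]
  exact pow_eq_zero_iff two_ne_zero |>.1 (le_antisymm this (sq_nonneg _))

theorem exists_isMinimizer [FiniteDimensional ℝ E] {Q : E → EReal}
    (hlsc : LowerSemicontinuous Q) {u₀ : E} (h₀ : Q u₀ ≠ ⊤) {c B a : ℝ} (hc : 0 < c)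
    (hlow : ∀ u, ((c * ‖u‖ ^ 2 - B * ‖u‖ + a : ℝ) : EReal) ≤ Q u) :
    ∃ u, IsMinimizer Q u ∧ ∃ m : ℝ, Q u = m := by
  have hbot : ∀ u, Q u ≠ ⊥ := fun u h => by
    have := hlow u
    rw [h] at this
    exact EReal.coe_ne_bot _ (le_bot_iff.1 this)
  obtain ⟨b, hb⟩ := EReal.exists_coe_of_ne (hbot u₀) h₀
  -- Outside this ball the quadratic minorant already exceeds the value `b` at `u₀`.
  set r : ℝ := max ‖u₀‖ ((|B| + |b - a|) / c + 1) with hr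
  have hcpt : IsCompact (Metric.closedBall (0 : E) r) := isCompact_closedBall _ _
  have hu₀ : u₀ ∈ Metric.closedBall (0 : E) r := by simp [hr]
  obtain ⟨u, -, hu⟩ := (hlsc.lowerSemicontinuousOn _).exists_isMinOn ⟨u₀, hu₀⟩ hcpt
  have hmin : IsMinimizer Q u := by
    intro v
    by_cases hv : v ∈ Metric.closedBall (0 : E) r
    · exact hu hv
    · refine (hu hu₀).trans ((le_trans ?_ (hlow v)))
      rw [hb, EReal.coe_le_coe_iff]
      have hvr : (|B| + |b - a|) / c + 1 < ‖v‖ := by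
        have : r < ‖v‖ := by simpa using hv
        exact (le_max_right _ _).trans_lt this
      have h1 : |B| + |b - a| + c < c * ‖v‖ := by
        have := mul_lt_mul_of_pos_left hvr hc
        rwa [mul_add, mul_div_cancel₀ _ hc.ne', mul_one] at this
      have h2 : 1 ≤ ‖v‖ := by
        have : 0 ≤ (|B| + |b - a|) / c := by positivity
        linarith
      have h3 : (|B| + |b - a| + c) * ‖v‖ ≤ c * ‖v‖ * ‖v‖ := by gcongr
      have h4 : B * ‖v‖ ≤ |B| * ‖v‖ := by gcongr; exact le_abs_self B
      have h5 : |b - a| * 1 ≤ |b - a| * ‖v‖ := by gcongr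
      have h6 := le_abs_self (b - a)
      nlinarith
  exact ⟨u, hmin, EReal.exists_coe_of_ne (hbot u) fun h => h₀ (top_le_iff.1 (h ▸ hmin u₀))⟩

theorem HasSupport.convex_combo {c : ℝ} {q : E → ℝ} {G : E → E} (h : HasSupport c q G)
    (u v : E) {θ : ℝ} (h0 : 0 ≤ θ) (h1 : θ ≤ 1) :
    q ((1 - θ) • u + θ • v) ≤
      (1 - θ) * q u + θ * q v - c / 2 * (θ * (1 - θ)) * ‖u - v‖ ^ 2 := by
  set m := (1 - θ) • u + θ • v with hm
  have e1 : u - m = θ • (u - v) := by rw [hm]; module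
  have e2 : v - m = (-(1 - θ)) • (u - v) := by rw [hm]; module
  have hu := h m u
  have hv := h m v
  rw [e1, inner_smul_right, norm_smul, mul_pow, Real.norm_eq_abs, sq_abs] at hu
  rw [e2, inner_smul_right, norm_smul, mul_pow, Real.norm_eq_abs, sq_abs] at hv
  have hu' := mul_le_mul_of_nonneg_left hu (sub_nonneg.2 h1)
  have hv' := mul_le_mul_of_nonneg_left hv h0
  nlinarith

theorem HasSupport.strongConvexE_add {c : ℝ} {q : E → ℝ} {G : E → E} (h : HasSupport c q G)
    {Φ : E → EReal} (hΦ : StrongConvexE 0 Φ) :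
    StrongConvexE c fun u => (q u : EReal) + Φ u := by
  intro u v a b θ h0 h1 hu hv
  rw [EReal.coe_add_le_coe_iff] at hu hv ⊢
  refine (hΦ h0 h1 hu hv).trans ?_
  rw [EReal.coe_le_coe_iff]
  have := h.convex_combo u v h0 h1
  linarith

theorem ProperClosedConvex.ne_bot {Φ : E → EReal} (hΦ : ProperClosedConvex Φ) (u : E) :
    Φ u ≠ ⊥ := by
  obtain ⟨B, a, h⟩ := hΦ.minorant
  intro hu
  have := h u
  rw [hu] at this
  exact EReal.coe_ne_bot _ (le_bot_iff.1 this)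

theorem existsUnique_isMinimizer_add [FiniteDimensional ℝ E] {c : ℝ} (hc : 0 < c) {q : E → ℝ}
    {G : E → E} (hq : HasSupport c q G) (hqc : Continuous q) {Φ : E → EReal}
    (hΦ : ProperClosedConvex Φ) : ∃! u, IsMinimizer (fun u => (q u : EReal) + Φ u) u := by
  obtain ⟨B, a, hB⟩ := hΦ.minorant
  obtain ⟨u₀, hu₀⟩ := hΦ.proper
  have hlow : ∀ u, ((c / 2 * ‖u‖ ^ 2 - (‖G 0‖ + B) * ‖u‖ + (q 0 + a) : ℝ) : EReal) ≤
      (q u : EReal) + Φ u := by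
    intro u
    refine le_trans ?_ (add_le_add le_rfl (hB u))
    rw [← EReal.coe_add, EReal.coe_le_coe_iff]
    have h1 := hq 0 u
    rw [sub_zero] at h1
    have h2 := neg_le_of_abs_le (abs_real_inner_le_norm (G 0) u)
    linarith
  have htop : (q u₀ : EReal) + Φ u₀ ≠ ⊤ := by
    obtain ⟨r, hr⟩ := EReal.exists_coe_of_ne (hΦ.ne_bot u₀) hu₀
    rw [hr, ← EReal.coe_add]
    exact EReal.coe_ne_top _
  obtain ⟨u, hu, m, hm⟩ := exists_isMinimizer (Q := fun u => (q u : EReal) + Φ u)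
    (lowerSemicontinuous_coe_add hqc hΦ.lsc) htop (half_pos hc) hlow
  exact ⟨u, hu, fun v hv => (hq.strongConvexE_add hΦ.convex).unique hc hu hv hm⟩

theorem IsMinimizer.coe_add_finite {q : E → ℝ} {Φ : E → EReal} (hΦ : ProperClosedConvex Φ)
    {u : E} (hu : IsMinimizer (fun u => (q u : EReal) + Φ u) u) : ∃ r : ℝ, Φ u = r := by
  refine EReal.exists_coe_of_ne (hΦ.ne_bot u) fun h => ?_
  obtain ⟨u₀, hu₀⟩ := hΦ.proper
  obtain ⟨r, hr⟩ := EReal.exists_coe_of_ne (hΦ.ne_bot u₀) hu₀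
  have := hu u₀
  simp only [h, hr, EReal.coe_add_top, ← EReal.coe_add, top_le_iff] at this
  exact EReal.coe_ne_top _ this

theorem IsMinimizer.growth_add {c : ℝ} {q : E → ℝ} {G : E → E} (hq : HasSupport c q G)
    {Φ : E → EReal} (hΦ : StrongConvexE 0 Φ) {u v : E}
    (hu : IsMinimizer (fun u => (q u : EReal) + Φ u) u) {r b : ℝ} (hr : Φ u = r) (hb : Φ v = b) :
    q u + r + c / 2 * ‖v - u‖ ^ 2 ≤ q v + b :=
  (hq.strongConvexE_add hΦ).growth hu (m := q u + r) (b := q v + b)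
    (by simp [hr]) (by simp [hb])

end Minimizers

/-- The error of the affine approximation lies between 0 and a quadratic, hence is o(‖y - x‖). -/
theorem hasGradientAt_of_sandwich {E : Type*} [NormedAddCommGroup E] [InnerProductSpace ℝ E]
    [CompleteSpace E] {f : E → ℝ} {G x : E} {K : ℝ}
    (hlow : ∀ y, f x + inner ℝ G (y - x) ≤ f y)
    (hupp : ∀ y, f y ≤ f x + inner ℝ G (y - x) + K * ‖y - x‖ ^ 2) : HasGradientAt f G x := by
  rw [hasGradientAt_iff_isLittleO]
  have h1 : (fun y => f y - f x - inner ℝ G (y - x)) =O[nhds x] fun y => ‖y - x‖ ^ 2 := by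
    refine Asymptotics.IsBigO.of_bound K (Filter.Eventually.of_forall fun y => ?_)
    have := hlow y
    have := hupp y
    rw [Real.norm_eq_abs, Real.norm_eq_abs, abs_of_nonneg (by linarith),
      abs_of_nonneg (by positivity)]
    linarith
  refine h1.trans_isLittleO ?_
  have h2 : Filter.Tendsto (fun y => y - x) (nhds x) (nhds 0) := by
    have : Continuous fun y : E => y - x := by fun_prop
    simpa using this.tendsto x
  have := (Asymptotics.isLittleO_norm_pow_id (E' := E) one_lt_two).comp_tendsto h2
  simpa [Function.comp_def] using this

/-! ### The conjugate of a strongly convex function -/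

section StrongConjugate

variable {E : Type*} [NormedAddCommGroup E] [InnerProductSpace ℝ E] [FiniteDimensional ℝ E]
  {g : E → ℝ}

/-- No subgradient is needed: `g` has a minimum on the unit ball by compactness, and for ‖u‖ > 1
strong convexity on the segment from 0 to `u`, at the point u/‖u‖ of the ball, bounds g(u) from
below. -/
theorem StrongConvexOn.exists_quadratic_minorant (hg : StrongConvexOn Set.univ 1 g) :
    ∃ B a : ℝ, ∀ u, 1 / 2 * ‖u‖ ^ 2 - B * ‖u‖ + a ≤ g u := by
  have hcont : Continuous g := continuousOn_univ.1 ((hg.convexOn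
    (by intro r; dsimp; positivity)).continuousOn isOpen_univ)
  obtain ⟨u₁, -, hu₁⟩ := (isCompact_closedBall (0 : E) 1).exists_isMinOn
    ⟨0, by simp⟩ hcont.continuousOn
  have h0 : g u₁ ≤ g 0 := hu₁ (by simp)
  refine ⟨1 / 2 + g 0 - g u₁, g u₁ - 1 / 2, fun u => ?_⟩
  have hn := norm_nonneg u
  rcases le_or_gt ‖u‖ 1 with h | h
  · have : g u₁ ≤ g u := hu₁ (by simpa using h)
    nlinarith
  · have hpos : 0 < ‖u‖ := by linarith
    have hlt : ‖u‖⁻¹ < 1 := inv_lt_one_of_one_lt₀ h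
    have hs := hg.2 (Set.mem_univ (0 : E)) (Set.mem_univ u)
      (sub_nonneg.2 hlt.le) (inv_nonneg.2 hn) (by ring)
    have hm : g u₁ ≤ g ((1 - ‖u‖⁻¹) • (0 : E) + ‖u‖⁻¹ • u) := by
      refine hu₁ ?_
      simp [norm_smul, hpos.ne']
    simp only [zero_sub, norm_neg, smul_eq_mul] at hs
    have hs' := mul_le_mul_of_nonneg_left (hm.trans hs) hn
    have e : ‖u‖ * ((1 - ‖u‖⁻¹) * g 0 + ‖u‖⁻¹ * g u
        - (1 - ‖u‖⁻¹) * ‖u‖⁻¹ * (1 / 2 * ‖u‖ ^ 2)) =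
        (‖u‖ - 1) * g 0 + g u - 1 / 2 * (‖u‖ - 1) * ‖u‖ := by
      field_simp
    rw [e] at hs'
    nlinarith

theorem StrongConvexOn.exists_conj_max (hg : StrongConvexOn Set.univ 1 g) (v : E) :
    ∃ w, ∀ u, inner ℝ u v - g u + 1 / 2 * ‖u - w‖ ^ 2 ≤ inner ℝ w v - g w := by
  have hcont : Continuous g := continuousOn_univ.1 ((hg.convexOn
    (by intro r; dsimp; positivity)).continuousOn isOpen_univ)
  obtain ⟨B, a, hB⟩ := hg.exists_quadratic_minorant
  have hlsc : LowerSemicontinuous fun u => ((g u - inner ℝ u v : ℝ) : EReal) :=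
    (continuous_coe_real_ereal.comp (by fun_prop)).lowerSemicontinuous
  obtain ⟨w, hw, -⟩ := exists_isMinimizer (Q := fun u => ((g u - inner ℝ u v : ℝ) : EReal))
    (u₀ := 0) hlsc (EReal.coe_ne_top _) (c := 1 / 2) (B := B + ‖v‖) (a := a) (by norm_num) (by
      intro u
      rw [EReal.coe_le_coe_iff]
      have h1 := hB u
      have h2 := le_of_abs_le (abs_real_inner_le_norm u v)
      linarith)
  have hQ : StrongConvexE 1 fun u => ((g u - inner ℝ u v : ℝ) : EReal) := by
    intro x y b₁ b₂ θ h0 h1 hx hy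
    simp only [EReal.coe_le_coe_iff] at hx hy ⊢
    have h := hg.2 (Set.mem_univ x) (Set.mem_univ y) (sub_nonneg.2 h1) h0 (by ring)
    simp only [smul_eq_mul] at h
    rw [inner_add_left, real_inner_smul_left, real_inner_smul_left]
    have hx' := mul_le_mul_of_nonneg_left hx (sub_nonneg.2 h1)
    have hy' := mul_le_mul_of_nonneg_left hy h0
    linarith
  refine ⟨w, fun u => ?_⟩
  have := hQ.growth (v := u) hw rfl le_rfl
  linarith

/-- The maximizer in the definition of `g^*(v)`. -/
noncomputable def conjMax (g : E → ℝ) (v : E) : E :=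
  Classical.epsilon fun w =>
    ∀ u, inner ℝ u v - g u + 1 / 2 * ‖u - w‖ ^ 2 ≤ inner ℝ w v - g w

theorem conjMax_spec (hg : StrongConvexOn Set.univ 1 g) (v u : E) :
    inner ℝ u v - g u + 1 / 2 * ‖u - conjMax g v‖ ^ 2 ≤
      inner ℝ (conjMax g v) v - g (conjMax g v) :=
  Classical.epsilon_spec (hg.exists_conj_max v) u

theorem convexConj_eq_conjMax (hg : StrongConvexOn Set.univ 1 g) (v : E) :
    convexConj g v = ((inner ℝ (conjMax g v) v - g (conjMax g v) : ℝ) : EReal) := by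
  refine le_antisymm (iSup_le fun u => ?_)
    (le_iSup (fun z => ((inner ℝ z v - g z : ℝ) : EReal)) (conjMax g v))
  rw [EReal.coe_le_coe_iff]
  have := conjMax_spec hg v u
  have : 0 ≤ 1 / 2 * ‖u - conjMax g v‖ ^ 2 := by positivity
  linarith

theorem toReal_convexConj (hg : StrongConvexOn Set.univ 1 g) (v : E) :
    (convexConj g v).toReal = inner ℝ (conjMax g v) v - g (conjMax g v) := by
  rw [convexConj_eq_conjMax hg, EReal.toReal_coe]

theorem conj_lower (hg : StrongConvexOn Set.univ 1 g) (v v' : E) :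
    (convexConj g v).toReal + inner ℝ (conjMax g v) (v' - v) ≤ (convexConj g v').toReal := by
  rw [toReal_convexConj hg, toReal_convexConj hg, inner_sub_right]
  have := conjMax_spec hg v' (conjMax g v)
  have : 0 ≤ 1 / 2 * ‖conjMax g v - conjMax g v'‖ ^ 2 := by positivity
  linarith

/-- The maximizer at v' is a competitor at v, with a quadratic loss. Completing the square against
v' - v turns strong convexity of `g` into 1-smoothness of g^*. -/
theorem conj_upper (hg : StrongConvexOn Set.univ 1 g) (v v' : E) :
    (convexConj g v').toReal ≤
      (convexConj g v).toReal + inner ℝ (conjMax g v) (v' - v) + 1 / 2 * ‖v' - v‖ ^ 2 := by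
  rw [toReal_convexConj hg, toReal_convexConj hg]
  have h1 := conjMax_spec hg v (conjMax g v')
  have h2 : 0 ≤ ‖(conjMax g v' - conjMax g v) - (v' - v)‖ ^ 2 := by positivity
  rw [norm_sub_sq_real] at h2
  have h3 : inner ℝ (conjMax g v' - conjMax g v) (v' - v) =
      inner ℝ (conjMax g v') v' - inner ℝ (conjMax g v') v - inner ℝ (conjMax g v) (v' - v) := by
    rw [inner_sub_left, inner_sub_right]
  linarith

theorem hasGradientAt_conj (hg : StrongConvexOn Set.univ 1 g) (v : E) :
    HasGradientAt (fun v => (convexConj g v).toReal) (conjMax g v) v :=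
  hasGradientAt_of_sandwich (conj_lower hg v) (conj_upper hg v)

/-- Adding the two strong optimality inequalities gives ‖Δ‖² ≤ ⟨Δ, v' - v⟩ for the difference Δ of
the maximizers; Cauchy–Schwarz concludes. -/
theorem norm_conjMax_sub_le (hg : StrongConvexOn Set.univ 1 g) (v v' : E) :
    ‖conjMax g v' - conjMax g v‖ ≤ ‖v' - v‖ := by
  have h1 := conjMax_spec hg v (conjMax g v')
  have h2 := conjMax_spec hg v' (conjMax g v)
  rw [norm_sub_rev] at h2
  have h3 := le_of_abs_le (abs_real_inner_le_norm (conjMax g v' - conjMax g v) (v' - v))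
  rw [inner_sub_left, inner_sub_right, inner_sub_right] at h3
  have h4 : ‖conjMax g v' - conjMax g v‖ * ‖conjMax g v' - conjMax g v‖ ≤
      ‖conjMax g v' - conjMax g v‖ * ‖v' - v‖ := by nlinarith
  rcases (norm_nonneg (conjMax g v' - conjMax g v)).eq_or_lt with h | h
  · rw [← h]; exact norm_nonneg _
  · exact le_of_mul_le_mul_left h4 h

end StrongConjugate

/-! ### Smooth convex losses and their conjugates -/

section Scalar

variable {φ : ℝ → ℝ} {γ : ℝ}

theorem ConvexOn.deriv_support (hφ : ConvexOn ℝ Set.univ φ) (hd : Differentiable ℝ φ) (z t : ℝ) :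
    φ z + deriv φ z * (t - z) ≤ φ t := by
  rcases lt_trichotomy z t with h | rfl | h
  · have := hφ.le_slope_of_hasDerivAt (Set.mem_univ _) (Set.mem_univ _) h (hd z).hasDerivAt
    rw [slope_def_field, le_div_iff₀ (by linarith)] at this
    linarith
  · simp
  · have := hφ.slope_le_of_hasDerivAt (Set.mem_univ _) (Set.mem_univ _) h (hd z).hasDerivAt
    rw [slope_def_field, div_le_iff₀ (by linarith)] at this
    linarith

/-- The quadratic (s - z)²/(2γ) minus φ has a monotone derivative, so it is convex and lies above
its tangent at z. -/
theorem le_of_lipschitz_deriv (hd : Differentiable ℝ φ)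
    (hs : ∀ a b, |deriv φ a - deriv φ b| ≤ 1 / γ * |a - b|) (z t : ℝ) :
    φ t ≤ φ z + deriv φ z * (t - z) + 1 / (2 * γ) * (t - z) ^ 2 := by
  set ψ : ℝ → ℝ := fun s => 1 / (2 * γ) * (s - z) ^ 2 - φ s with hψ
  have hder : ∀ s, HasDerivAt ψ (1 / γ * (s - z) - deriv φ s) s := by
    intro s
    have h1 : HasDerivAt (fun s : ℝ => (s - z) ^ 2) (2 * (s - z)) s := by
      simpa using ((hasDerivAt_id s).sub_const z).fun_pow 2
    have h2 := (h1.const_mul (1 / (2 * γ))).sub (hd s).hasDerivAt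
    have e : 1 / (2 * γ) * (2 * (s - z)) = 1 / γ * (s - z) := by
      rw [one_div, mul_inv]; ring
    rw [e] at h2
    exact h2
  have hdψ : Differentiable ℝ ψ := fun s => (hder s).differentiableAt
  have hmono : Monotone (deriv ψ) := by
    intro a b hab
    rw [(hder a).deriv, (hder b).deriv]
    have h1 := hs b a
    rw [abs_of_nonneg (sub_nonneg.2 hab)] at h1
    have h2 := le_of_abs_le h1
    linarith
  have := (hmono.convexOn_univ_of_deriv hdψ).deriv_support hdψ z t
  rw [(hder z).deriv] at this
  simp only [hψ, sub_self] at this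
  linarith

theorem convexConj_le_iff (s a : ℝ) :
    convexConj φ s ≤ (a : EReal) ↔ ∀ z, s * z - φ z ≤ a := by
  unfold convexConj
  rw [iSup_le_iff]
  simp only [EReal.coe_le_coe_iff]
  rfl

theorem convexConj_ne_bot (s : ℝ) : convexConj φ s ≠ ⊥ := by
  intro h
  have := le_iSup (fun z => ((inner ℝ z s - φ z : ℝ) : EReal)) 0
  change _ ≤ convexConj φ s at this
  rw [h] at this
  exact EReal.coe_ne_bot _ (le_bot_iff.1 this)

theorem convexConj_deriv (hφ : ConvexOn ℝ Set.univ φ) (hd : Differentiable ℝ φ) (z : ℝ) :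
    convexConj φ (deriv φ z) = ((deriv φ z * z - φ z : ℝ) : EReal) := by
  refine le_antisymm ((convexConj_le_iff _ _).2 fun t => ?_) ?_
  · have := hφ.deriv_support hd z t
    linarith
  · exact le_iSup (fun t => ((inner ℝ t (deriv φ z) - φ t : ℝ) : EReal)) z

/-- `φ^* - (γ/2) t^2` is a supremum of affine functions if `φ` is `1/γ`-smooth. -/
theorem convexConj_le_iff_affine (hγ : 0 < γ) (hd : Differentiable ℝ φ)
    (hs : ∀ a b, |deriv φ a - deriv φ b| ≤ 1 / γ * |a - b|) (s a : ℝ) :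
    convexConj φ s ≤ ((a + γ / 2 * s ^ 2 : ℝ) : EReal) ↔
      ∀ z, (z - γ * deriv φ z) * s + (γ / 2 * deriv φ z ^ 2 - φ z) ≤ a := by
  rw [convexConj_le_iff]
  constructor
  -- The test point maximizes s·t minus the quadratic upper bound of φ at z.
  · intro h z
    have h1 := h (z + γ * (s - deriv φ z))
    have h2 := le_of_lipschitz_deriv hd hs z (z + γ * (s - deriv φ z))
    have e : 1 / (2 * γ) * (z + γ * (s - deriv φ z) - z) ^ 2 =
        γ / 2 * (s - deriv φ z) ^ 2 := by
      field_simp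
      ring
    rw [e] at h2
    nlinarith
  -- The two sides differ by the square (γ/2)(s - φ'(z))².
  · intro h z
    have h1 := h z
    have : 0 ≤ γ / 2 * (s - deriv φ z) ^ 2 := by positivity
    nlinarith

end Scalar

/-! ### Sums in `EReal` and separable proper closed convex functions -/

section ERealSums

variable {ι : Type*} (s : Finset ι)

theorem EReal.sum_coe (r : ι → ℝ) : ∑ i ∈ s, (r i : EReal) = ((∑ i ∈ s, r i : ℝ) : EReal) := by
  classical
  induction s using Finset.induction_on with
  | empty => simp
  | insert a s ha ih => rw [Finset.sum_insert ha, Finset.sum_insert ha, ih, EReal.coe_add]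

variable {s}

theorem EReal.sum_ne_bot {x : ι → EReal} (h : ∀ i ∈ s, x i ≠ ⊥) : ∑ i ∈ s, x i ≠ ⊥ := by
  classical
  induction s using Finset.induction_on with
  | empty => simp
  | insert a s ha ih =>
    rw [Finset.sum_insert ha, Ne, EReal.add_eq_bot_iff, not_or]
    exact ⟨h a (by simp), ih fun i hi => h i (by simp [hi])⟩

theorem EReal.sum_eq_top {x : ι → EReal} (h : ∀ i ∈ s, x i ≠ ⊥) {j : ι} (hj : j ∈ s)
    (ht : x j = ⊤) : ∑ i ∈ s, x i = ⊤ := by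
  classical
  rw [← Finset.add_sum_erase s x hj, ht]
  exact EReal.top_add_of_ne_bot (EReal.sum_ne_bot fun i hi => h i (Finset.mem_of_mem_erase hi))

theorem EReal.sum_eq_bot {x : ι → EReal} {j : ι} (hj : j ∈ s) (ht : x j = ⊥) :
    ∑ i ∈ s, x i = ⊥ := by
  classical
  rw [← Finset.add_sum_erase s x hj, ht, EReal.bot_add]

end ERealSums

/-- Real sublevel sets are intersections of closed sets cut out by affine inequalities; convexity
and the minorant are read off the affine functions. -/
theorem properClosedConvex_of_affine {Ψ : ℝ → EReal} (a b : ℝ → ℝ)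
    (h : ∀ t c : ℝ, Ψ t ≤ c ↔ ∀ z, a z * t + b z ≤ c) (hp : ∃ t, Ψ t ≠ ⊤) :
    ProperClosedConvex Ψ := by
  have hlow : ∀ t z, ((a z * t + b z : ℝ) : EReal) ≤ Ψ t := by
    intro t z
    cases hΨ : Ψ t with
    | bot =>
      have := (h t (a z * t + b z - 1)).1 (hΨ ▸ bot_le) z
      linarith
    | top => exact le_top
    | coe r => exact EReal.coe_le_coe_iff.2 ((h t r).1 hΨ.le z)
  refine ⟨?_, ?_, hp, |a 0|, b 0, fun t => ?_⟩
  · rw [lowerSemicontinuous_iff_isClosed_preimage]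
    intro y
    cases y with
    | bot =>
      have : Ψ ⁻¹' Set.Iic ⊥ = ∅ := by
        ext t
        simp only [Set.mem_preimage, Set.mem_Iic, Set.mem_empty_iff_false, iff_false]
        exact fun ht => EReal.coe_ne_bot _ (le_bot_iff.1 ((hlow t 0).trans ht))
      exact this ▸ isClosed_empty
    | top => simp
    | coe c =>
      have : Ψ ⁻¹' Set.Iic (c : EReal) = ⋂ z, {t | a z * t + b z ≤ c} := by
        ext t
        simpa using h t c
      exact this ▸ isClosed_iInter fun z => isClosed_le (by fun_prop) continuous_const
  · intro u v c₁ c₂ θ h0 h1 hu hv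
    rw [h] at hu hv ⊢
    intro z
    have hu' := mul_le_mul_of_nonneg_left (hu z) (sub_nonneg.2 h1)
    have hv' := mul_le_mul_of_nonneg_left (hv z) h0
    simp only [smul_eq_mul]
    linarith
  · refine le_trans (EReal.coe_le_coe_iff.2 ?_) (hlow t 0)
    have := neg_le_of_abs_le (abs_mul (a 0) t).le
    rw [Real.norm_eq_abs]
    linarith

theorem ProperClosedConvex.sum {n : ℕ} {Ψ : Fin n → ℝ → EReal}
    (h : ∀ i, ProperClosedConvex (Ψ i)) :
    ProperClosedConvex fun u : EuclideanSpace ℝ (Fin n) => ∑ i, Ψ i (u i) := by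
  have hbot : ∀ i t, Ψ i t ≠ ⊥ := fun i t => (h i).ne_bot t
  have hreal : ∀ (u : EuclideanSpace ℝ (Fin n)) (c : ℝ), ∑ i, Ψ i (u i) ≤ c →
      ∃ r : Fin n → ℝ, (∀ i, Ψ i (u i) = r i) ∧ ∑ i, r i ≤ c := by
    intro u c hu
    have : ∀ i, ∃ r : ℝ, Ψ i (u i) = r := fun i => EReal.exists_coe_of_ne (hbot _ _) fun ht => by
      rw [EReal.sum_eq_top (fun i _ => hbot i (u i)) (Finset.mem_univ i) ht, top_le_iff] at hu
      exact EReal.coe_ne_top _ hu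
    choose r hr using this
    refine ⟨r, hr, ?_⟩
    simp_rw [hr] at hu
    rwa [EReal.sum_coe, EReal.coe_le_coe_iff] at hu
  refine ⟨?_, ?_, ?_, ?_⟩
  · have key : ∀ s : Finset (Fin n),
        LowerSemicontinuous fun u : EuclideanSpace ℝ (Fin n) => ∑ i ∈ s, Ψ i (u i) := by
      intro s
      induction s using Finset.induction_on with
      | empty => simpa using lowerSemicontinuous_const
      | insert a s ha ih =>
        simp_rw [Finset.sum_insert ha]
        refine LowerSemicontinuous.add'
          ((h a).lsc.comp (g := fun u : EuclideanSpace ℝ (Fin n) => u a) (by fun_prop)) ih ?_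
        intro u
        exact EReal.continuousAt_add (Or.inr (EReal.sum_ne_bot fun i _ => hbot _ _))
          (Or.inl (hbot _ _))
    exact key _
  · intro u v c₁ c₂ θ h0 h1 hu hv
    obtain ⟨r, hr, hrc⟩ := hreal u c₁ hu
    obtain ⟨q, hq, hqc⟩ := hreal v c₂ hv
    calc ∑ i, Ψ i (((1 - θ) • u + θ • v) i)
        ≤ ∑ i, (((1 - θ) * r i + θ * q i : ℝ) : EReal) := by
          refine Finset.sum_le_sum fun i _ => ?_
          have := (h i).convex h0 h1 (hr i).le (hq i).le
          simpa using this
      _ ≤ _ := by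
          rw [EReal.sum_coe, EReal.coe_le_coe_iff, Finset.sum_add_distrib, ← Finset.mul_sum,
            ← Finset.mul_sum]
          have := mul_le_mul_of_nonneg_left hrc (sub_nonneg.2 h1)
          have := mul_le_mul_of_nonneg_left hqc h0
          linarith
  · choose t ht using fun i => (h i).proper
    choose r hr using fun i => EReal.exists_coe_of_ne (hbot i (t i)) (ht i)
    refine ⟨WithLp.toLp 2 t, ?_⟩
    simp only [hr, EReal.sum_coe]
    exact EReal.coe_ne_top _
  · choose B a hB using fun i => (h i).minorant
    refine ⟨∑ i, |B i|, ∑ i, a i, fun u => ?_⟩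
    calc ((-(∑ i, |B i|) * ‖u‖ + ∑ i, a i : ℝ) : EReal)
        ≤ ∑ i, ((-B i * ‖u i‖ + a i : ℝ) : EReal) := by
          rw [EReal.sum_coe, EReal.coe_le_coe_iff, Finset.sum_add_distrib, neg_mul,
            Finset.sum_mul, ← Finset.sum_neg_distrib]
          gcongr with i
          have h1 : B i * ‖u i‖ ≤ |B i| * ‖u i‖ := by gcongr; exact le_abs_self _
          have h2 : |B i| * ‖u i‖ ≤ |B i| * ‖u‖ := by gcongr; exact PiLp.norm_apply_le u i
          linarith
      _ ≤ _ := Finset.sum_le_sum fun i _ => hB i (u i)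

section Support

variable {E : Type*} [NormedAddCommGroup E] [InnerProductSpace ℝ E]

theorem HasSupport.add {c₁ c₂ : ℝ} {q₁ q₂ : E → ℝ} {G₁ G₂ : E → E} (h₁ : HasSupport c₁ q₁ G₁)
    (h₂ : HasSupport c₂ q₂ G₂) :
    HasSupport (c₁ + c₂) (fun u => q₁ u + q₂ u) (fun u => G₁ u + G₂ u) := by
  intro y x
  have := h₁ y x
  have := h₂ y x
  rw [inner_add_left]
  linarith

theorem hasSupport_inner (l : E) : HasSupport 0 (fun u => inner ℝ l u) fun _ => l := by
  intro y x
  rw [inner_sub_right]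
  linarith

theorem quadratic_expand (c : ℝ) (a y x : E) :
    c / 2 * ‖x - a‖ ^ 2 =
      c / 2 * ‖y - a‖ ^ 2 + inner ℝ (c • (y - a)) (x - y) + c / 2 * ‖x - y‖ ^ 2 := by
  have e : x - a = (y - a) + (x - y) := by abel
  rw [e, norm_add_sq_real, real_inner_smul_left]
  ring

theorem hasSupport_quadratic (c : ℝ) (a : E) :
    HasSupport c (fun u => c / 2 * ‖u - a‖ ^ 2) fun u => c • (u - a) :=
  fun y x => (quadratic_expand c a y x).ge

end Support

/-! ### The dual problem: domains, splittings, smoothness, existence of minimizers -/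

namespace ERM

variable {n d : ℕ} (p : ERM n d)

/-- The domain of `Ψ_i`. -/
def dom (i : Fin n) : Set ℝ := {t | convexConj (p.φ i) (-t) ≠ ⊤}

/-- `φ_i^*(-t)` as a real number. -/
noncomputable def conjR (i : Fin n) (t : ℝ) : ℝ := (convexConj (p.φ i) (-t)).toReal

/-- `Ψ_i(t)` as a real number. -/
noncomputable def psiR (i : Fin n) (t : ℝ) : ℝ := 1 / n * (p.conjR i t - p.γ / 2 * t ^ 2)

/-- The sum of the functions `Ψ_i(x_i)`. -/
noncomputable def psiSum (x : EuclideanSpace ℝ (Fin n)) : EReal := ∑ i, p.ΨSplit i (x i)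

/-- The gradient of `x ↦ λ g^*((1/(λ n)) A x)`. -/
noncomputable def gradSimple (x : EuclideanSpace ℝ (Fin n)) : EuclideanSpace ℝ (Fin n) :=
  (1 / n : ℝ) • ContinuousLinearMap.adjoint p.mat (conjMax p.g (p.scaled x))

/-- The gradient of the smooth part of the splitting used by APCG. -/
noncomputable def gradSplit (x : EuclideanSpace ℝ (Fin n)) : EuclideanSpace ℝ (Fin n) :=
  p.gradSimple x + (p.γ / n) • (x - 0)

variable {p}

theorem conj_eq_conjR {i : Fin n} {t : ℝ} (ht : t ∈ p.dom i) :
    convexConj (p.φ i) (-t) = (p.conjR i t : EReal) :=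
  (EReal.coe_toReal ht (convexConj_ne_bot _)).symm

theorem ΨSplit_of_mem {i : Fin n} {t : ℝ} (ht : t ∈ p.dom i) :
    p.ΨSplit i t = (p.psiR i t : EReal) := by
  rw [ΨSplit, conj_eq_conjR ht, psiR]
  push_cast
  rfl

theorem ΨSplit_of_notMem (hn : 0 < n) {i : Fin n} {t : ℝ} (ht : t ∉ p.dom i) :
    p.ΨSplit i t = ⊤ := by
  have h : convexConj (p.φ i) (-t) = ⊤ := not_not.1 ht
  have hn' : (0 : ℝ) < 1 / n := by positivity
  rw [ΨSplit, h, EReal.top_sub_coe, EReal.coe_mul_top_of_pos hn']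

theorem mem_dom_of_ΨSplit_le (hn : 0 < n) {i : Fin n} {t : ℝ} {c : ℝ}
    (h : p.ΨSplit i t ≤ c) : t ∈ p.dom i := by
  by_contra ht
  rw [ΨSplit_of_notMem hn ht, top_le_iff] at h
  exact EReal.coe_ne_top _ h

theorem le_conjR {i : Fin n} {t : ℝ} (ht : t ∈ p.dom i) (z : ℝ) :
    -t * z - p.φ i z ≤ p.conjR i t :=
  (convexConj_le_iff _ _).1 (conj_eq_conjR ht).le z

theorem neg_deriv_mem_dom (hp : p.Regular) (i : Fin n) (z : ℝ) :
    -deriv (p.φ i) z ∈ p.dom i ∧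
      p.conjR i (-deriv (p.φ i) z) = deriv (p.φ i) z * z - p.φ i z := by
  have h := convexConj_deriv (hp.φ_convex i) (hp.φ_diff i) z
  constructor
  · rw [dom, Set.mem_ofPred_eq, neg_neg, h]
    exact EReal.coe_ne_top _
  · rw [conjR, neg_neg, h, EReal.toReal_coe]

theorem ΨSplit_le_iff (hn : 0 < n) (hp : p.Regular) (i : Fin n) (t c : ℝ) :
    p.ΨSplit i t ≤ c ↔ ∀ z, -(1 / n * (z - p.γ * deriv (p.φ i) z)) * t +
      1 / n * (p.γ / 2 * deriv (p.φ i) z ^ 2 - p.φ i z) ≤ c := by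
  have hn' : (0 : ℝ) < n := by positivity
  have h1 : p.ΨSplit i t ≤ c ↔
      convexConj (p.φ i) (-t) ≤ ((n * c + p.γ / 2 * (-t) ^ 2 : ℝ) : EReal) := by
    by_cases ht : t ∈ p.dom i
    · rw [ΨSplit_of_mem ht, conj_eq_conjR ht, EReal.coe_le_coe_iff, EReal.coe_le_coe_iff, psiR,
        one_div, inv_mul_le_iff₀ hn', neg_sq, sub_le_iff_le_add]
    · rw [ΨSplit_of_notMem hn ht, show convexConj (p.φ i) (-t) = ⊤ from not_not.1 ht,
        top_le_iff, top_le_iff]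
      simp only [EReal.coe_ne_top]
  rw [h1, convexConj_le_iff_affine hp.γ_pos (hp.φ_diff i) (hp.φ_smooth i)]
  refine forall_congr' fun z => ?_
  rw [← inv_mul_le_iff₀ hn', ← one_div]
  ring_nf

theorem properClosedConvex_ΨSplit (hn : 0 < n) (hp : p.Regular) (i : Fin n) :
    ProperClosedConvex (p.ΨSplit i) := by
  refine properClosedConvex_of_affine _ _ (ΨSplit_le_iff hn hp i)
    ⟨-deriv (p.φ i) 0, ?_⟩
  rw [ΨSplit_of_mem (neg_deriv_mem_dom hp i 0).1]
  exact EReal.coe_ne_top _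

theorem properClosedConvex_psiSum (hn : 0 < n) (hp : p.Regular) :
    ProperClosedConvex p.psiSum :=
  ProperClosedConvex.sum (properClosedConvex_ΨSplit hn hp)

theorem psiSum_of_mem {x : EuclideanSpace ℝ (Fin n)} (hx : ∀ i, x i ∈ p.dom i) :
    p.psiSum x = ((∑ i, p.psiR i (x i) : ℝ) : EReal) := by
  rw [psiSum, ← EReal.sum_coe]
  exact Finset.sum_congr rfl fun i _ => ΨSplit_of_mem (hx i)

theorem psiSum_of_notMem (hn : 0 < n) (hp : p.Regular) {x : EuclideanSpace ℝ (Fin n)}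
    {i : Fin n} (hx : x i ∉ p.dom i) : p.psiSum x = ⊤ :=
  EReal.sum_eq_top (fun j _ => (properClosedConvex_ΨSplit hn hp j).ne_bot _) (Finset.mem_univ i)
    (ΨSplit_of_notMem hn hx)

theorem mem_dom_of_psiSum (hn : 0 < n) (hp : p.Regular) {x : EuclideanSpace ℝ (Fin n)} {r : ℝ}
    (hr : p.psiSum x = r) (i : Fin n) : x i ∈ p.dom i := by
  by_contra h
  rw [psiSum_of_notMem hn hp h] at hr
  exact EReal.coe_ne_top _ hr.symm

theorem sum_psiR (x : EuclideanSpace ℝ (Fin n)) :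
    ∑ i, p.psiR i (x i) = 1 / n * ∑ i, p.conjR i (x i) - p.γ / (2 * n) * ‖x‖ ^ 2 := by
  simp only [psiR]
  rw [← Finset.mul_sum, Finset.sum_sub_distrib, ← Finset.mul_sum, EuclideanSpace.norm_sq_eq]
  simp only [Real.norm_eq_abs, sq_abs]
  rcases eq_or_ne (n : ℝ) 0 with h | h
  · simp [h]
  · field_simp

theorem gConj_eq (hp : p.Regular) (v : EuclideanSpace ℝ (Fin d)) :
    convexConj p.g v = (p.gConj v : EReal) := by
  rw [gConj, convexConj_eq_conjMax hp.g_strong, EReal.toReal_coe]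

theorem dual_of_mem (hp : p.Regular) {x : EuclideanSpace ℝ (Fin n)} (hx : ∀ i, x i ∈ p.dom i) :
    p.dual x = ((-(1 / n * ∑ i, p.conjR i (x i)) - p.fSimple x : ℝ) : EReal) := by
  have : ∀ i, -convexConj (p.φ i) (-(x i)) = ((-p.conjR i (x i) : ℝ) : EReal) := fun i => by
    rw [conj_eq_conjR (hx i), EReal.coe_neg]
  rw [dual, gConj_eq hp]
  simp_rw [this]
  rw [EReal.sum_coe, ← EReal.coe_mul, ← EReal.coe_mul, ← EReal.coe_sub, fSimple,
    Finset.sum_neg_distrib, mul_neg]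

theorem dual_of_notMem (hn : 0 < n) {x : EuclideanSpace ℝ (Fin n)} {i : Fin n}
    (hx : x i ∉ p.dom i) : p.dual x = ⊥ := by
  have h : convexConj (p.φ i) (-(x i)) = ⊤ := not_not.1 hx
  have hn' : (0 : ℝ) < 1 / n := by positivity
  rw [dual, EReal.sum_eq_bot (Finset.mem_univ i) (by rw [h, EReal.neg_top]),
    EReal.coe_mul_bot_of_pos hn', EReal.bot_sub]

/-- The quadratic term moved between the two parts of the splitting cancels on the domain; off the
domain both sides are `⊥`. -/
theorem dual_eq_neg (hn : 0 < n) (hp : p.Regular) (x : EuclideanSpace ℝ (Fin n)) :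
    p.dual x = -((p.fSplit x : EReal) + p.psiSum x) := by
  by_cases hx : ∀ i, x i ∈ p.dom i
  · rw [dual_of_mem hp hx, psiSum_of_mem hx, ← EReal.coe_add, ← EReal.coe_neg, sum_psiR, fSplit]
    congr 1
    ring
  · push Not at hx
    obtain ⟨i, hi⟩ := hx
    rw [dual_of_notMem hn hi, psiSum_of_notMem hn hp hi, EReal.coe_add_top, EReal.neg_top]

theorem mem_dom_of_dual_ne_bot (hn : 0 < n) {x : EuclideanSpace ℝ (Fin n)}
    (hx : p.dual x ≠ ⊥) (i : Fin n) : x i ∈ p.dom i := by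
  by_contra h
  exact hx (dual_of_notMem hn h)

theorem isDualOptimal_iff (hn : 0 < n) (hp : p.Regular) (x : EuclideanSpace ℝ (Fin n)) :
    p.IsDualOptimal x ↔ IsMinimizer (fun u => (p.fSplit u : EReal) + p.psiSum u) x := by
  simp only [IsDualOptimal, IsMinimizer, dual_eq_neg hn hp, EReal.neg_le_neg_iff]

theorem mat_apply (x : EuclideanSpace ℝ (Fin n)) : p.mat x = ∑ i, x i • p.A i := by
  simp [mat]

theorem mat_single (i : Fin n) (t : ℝ) : p.mat (EuclideanSpace.single i t) = t • p.A i := by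
  rw [mat_apply, Finset.sum_eq_single i]
  · simp
  · intro j _ hj
    simp [hj]
  · simp

theorem inner_gradSimple (y e : EuclideanSpace ℝ (Fin n)) :
    inner ℝ (p.gradSimple y) e = 1 / n * inner ℝ (conjMax p.g (p.scaled y)) (p.mat e) := by
  rw [gradSimple, real_inner_smul_left, ContinuousLinearMap.adjoint_inner_left]

theorem gradSimple_apply (y : EuclideanSpace ℝ (Fin n)) (i : Fin n) :
    p.gradSimple y i = 1 / n * inner ℝ (p.A i) (conjMax p.g (p.scaled y)) := by
  have h := inner_gradSimple (p := p) y (EuclideanSpace.single i 1)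
  rw [mat_single, one_smul, EuclideanSpace.inner_single_right] at h
  rw [real_inner_comm, ← h]
  simp

theorem scaled_sub (x y : EuclideanSpace ℝ (Fin n)) :
    p.scaled x - p.scaled y = (1 / (p.lam * n)) • p.mat (x - y) := by
  rw [scaled, scaled, map_sub, smul_sub]

theorem fSimple_lower (hn : 0 < n) (hp : p.Regular) (y x : EuclideanSpace ℝ (Fin n)) :
    p.fSimple y + inner ℝ (p.gradSimple y) (x - y) ≤ p.fSimple x := by
  have hl := hp.lam_pos
  have hn' : (0 : ℝ) < n := by positivity
  have h := mul_le_mul_of_nonneg_left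
    (conj_lower hp.g_strong (p.scaled y) (p.scaled x)) hl.le
  rw [scaled_sub, real_inner_smul_right, mul_add] at h
  rw [inner_gradSimple]
  refine le_trans (le_of_eq ?_) h
  rw [fSimple, gConj]
  field_simp

theorem fSimple_upper (hn : 0 < n) (hp : p.Regular) (y x : EuclideanSpace ℝ (Fin n)) :
    p.fSimple x ≤ p.fSimple y + inner ℝ (p.gradSimple y) (x - y) +
      1 / (2 * p.lam * n ^ 2) * ‖p.mat (x - y)‖ ^ 2 := by
  have hl := hp.lam_pos
  have hn' : (0 : ℝ) < n := by positivity
  have h := mul_le_mul_of_nonneg_left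
    (conj_upper hp.g_strong (p.scaled y) (p.scaled x)) hl.le
  rw [scaled_sub, real_inner_smul_right, norm_smul, mul_pow, Real.norm_eq_abs, sq_abs] at h
  rw [inner_gradSimple]
  refine le_trans h (le_of_eq ?_)
  rw [fSimple, gConj]
  field_simp

theorem norm_mat_sq_le (e : EuclideanSpace ℝ (Fin n)) :
    ‖p.mat e‖ ^ 2 ≤ ‖p.mat‖ ^ 2 * ‖e‖ ^ 2 := by
  rw [← mul_pow]
  gcongr
  exact p.mat.le_opNorm e

theorem fSimple_upper_norm (hn : 0 < n) (hp : p.Regular) (y x : EuclideanSpace ℝ (Fin n)) :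
    p.fSimple x ≤ p.fSimple y + inner ℝ (p.gradSimple y) (x - y) +
      ‖p.mat‖ ^ 2 / (2 * p.lam * n ^ 2) * ‖x - y‖ ^ 2 := by
  have hl := hp.lam_pos
  refine (fSimple_upper hn hp y x).trans ?_
  have : 1 / (2 * p.lam * n ^ 2) * ‖p.mat (x - y)‖ ^ 2 ≤
      1 / (2 * p.lam * n ^ 2) * (‖p.mat‖ ^ 2 * ‖x - y‖ ^ 2) := by
    gcongr
    exact norm_mat_sq_le _
  have e : ‖p.mat‖ ^ 2 / (2 * p.lam * n ^ 2) * ‖x - y‖ ^ 2 =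
      1 / (2 * p.lam * n ^ 2) * (‖p.mat‖ ^ 2 * ‖x - y‖ ^ 2) := by ring
  linarith

theorem hasGradientAt_fSimple (hn : 0 < n) (hp : p.Regular) (x : EuclideanSpace ℝ (Fin n)) :
    HasGradientAt p.fSimple (p.gradSimple x) x :=
  hasGradientAt_of_sandwich (fSimple_lower hn hp x) (fSimple_upper_norm hn hp x)

theorem fSplit_eq : p.fSplit = fun x => p.fSimple x + p.γ / n / 2 * ‖x - 0‖ ^ 2 := by
  funext x
  rw [fSplit, sub_zero]
  congr 2
  rw [div_div, mul_comm]

theorem hasSupport_fSimple (hn : 0 < n) (hp : p.Regular) :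
    HasSupport 0 p.fSimple p.gradSimple := by
  intro y x
  have := fSimple_lower hn hp y x
  linarith

theorem hasSupport_fSplit (hn : 0 < n) (hp : p.Regular) :
    HasSupport (p.γ / n) p.fSplit p.gradSplit := by
  have := (hasSupport_fSimple hn hp).add (hasSupport_quadratic (p.γ / n) 0)
  rw [zero_add] at this
  rw [fSplit_eq]
  exact this

theorem fSplit_upper (hn : 0 < n) (hp : p.Regular) (y x : EuclideanSpace ℝ (Fin n)) :
    p.fSplit x ≤ p.fSplit y + inner ℝ (p.gradSplit y) (x - y) +
      (1 / (2 * p.lam * n ^ 2) * ‖p.mat (x - y)‖ ^ 2 + p.γ / n / 2 * ‖x - y‖ ^ 2) := by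
  have h1 := fSimple_upper hn hp y x
  have h2 := quadratic_expand (p.γ / n) 0 y x
  rw [fSplit_eq, gradSplit, inner_add_left]
  simp only
  linarith

theorem hasGradientAt_fSplit (hn : 0 < n) (hp : p.Regular) (x : EuclideanSpace ℝ (Fin n)) :
    HasGradientAt p.fSplit (p.gradSplit x) x := by
  have hγ := hp.γ_pos
  refine hasGradientAt_of_sandwich
    (K := ‖p.mat‖ ^ 2 / (2 * p.lam * n ^ 2) + p.γ / n / 2) (fun y => ?_) (fun y => ?_)
  · have := hasSupport_fSplit hn hp x y
    have : 0 ≤ p.γ / n / 2 * ‖y - x‖ ^ 2 := by positivity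
    linarith
  · have h1 := fSimple_upper_norm hn hp x y
    have h2 := quadratic_expand (p.γ / n) 0 x y
    rw [fSplit_eq, gradSplit, inner_add_left]
    simp only
    linarith

/-- Moving by t along coordinate i changes Ax by t·A_i, which is the origin of L_i. -/
theorem fSplit_upper_single (hn : 0 < n) (hp : p.Regular) (y : EuclideanSpace ℝ (Fin n))
    (i : Fin n) (t : ℝ) :
    p.fSplit (y + EuclideanSpace.single i t) ≤
      p.fSplit y + p.gradSplit y i * t + p.Lip i / 2 * t ^ 2 := by
  have hl := hp.lam_pos
  have hn' : (0 : ℝ) < n := by positivity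
  refine (fSplit_upper hn hp y _).trans (le_of_eq ?_)
  rw [add_sub_cancel_left, mat_single, norm_smul, PiLp.norm_single,
    EuclideanSpace.inner_single_right, mul_pow, Real.norm_eq_abs, sq_abs, Lip]
  simp only [conj_trivial]
  field_simp

theorem continuous_fSplit (hn : 0 < n) (hp : p.Regular) : Continuous p.fSplit :=
  continuous_iff_continuousAt.2 fun x => (hasGradientAt_fSplit hn hp x).continuousAt

theorem gConj_hasGradientAt (hp : p.Regular) (v : EuclideanSpace ℝ (Fin d)) :
    HasGradientAt p.gConj (conjMax p.g v) v :=
  hasGradientAt_conj hp.g_strong v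

theorem omega_eq (hp : p.Regular) (x : EuclideanSpace ℝ (Fin n)) :
    p.omega x = conjMax p.g (p.scaled x) :=
  (gConj_hasGradientAt hp _).gradient

theorem existsUnique_isDualOptimal (hn : 0 < n) (hp : p.Regular) :
    ∃! xs, p.IsDualOptimal xs := by
  have hγ := hp.γ_pos
  simp only [isDualOptimal_iff hn hp]
  exact existsUnique_isMinimizer_add (by positivity) (hasSupport_fSplit hn hp)
    (continuous_fSplit hn hp) (properClosedConvex_psiSum hn hp)

/-- The smooth part of the model minimized by the proximal full gradient step. -/
noncomputable def fullSmooth (p : ERM n d) (x u : EuclideanSpace ℝ (Fin n)) : ℝ :=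
  inner ℝ (p.gradSimple x) u + ‖p.mat‖ ^ 2 / (p.lam * n ^ 2) / 2 * ‖u - x‖ ^ 2
    + p.γ / n / 2 * ‖u - 0‖ ^ 2

theorem fullModel_eq (hn : 0 < n) (hp : p.Regular) (x : EuclideanSpace ℝ (Fin n)) :
    p.fullModel x = fun u => (p.fullSmooth x u : EReal) + p.psiSum u := by
  funext u
  rw [fullModel, (hasGradientAt_fSimple hn hp x).gradient, ΨSimple]
  by_cases hu : ∀ i, u i ∈ p.dom i
  · simp_rw [conj_eq_conjR (hu _)]
    rw [psiSum_of_mem hu, EReal.sum_coe, ← EReal.coe_mul, ← EReal.coe_add, ← EReal.coe_add,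
      sum_psiR, fullSmooth, sub_zero]
    congr 1
    have hn' : (n : ℝ) ≠ 0 := by positivity
    have := hp.lam_pos.ne'
    field_simp
    ring
  · push Not at hu
    obtain ⟨i, hi⟩ := hu
    have hn' : (0 : ℝ) < 1 / n := by positivity
    have h : ∑ j, convexConj (p.φ j) (-(u j)) = ⊤ :=
      EReal.sum_eq_top (fun j _ => convexConj_ne_bot _) (Finset.mem_univ i) (not_not.1 hi)
    rw [psiSum_of_notMem hn hp hi, EReal.coe_add_top, h,
      EReal.coe_mul_top_of_pos hn', EReal.coe_add_top]

/-- The share γ/n, borrowed from the conjugates, keeps the modulus positive even when A = 0. -/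
theorem hasSupport_fullSmooth (x : EuclideanSpace ℝ (Fin n)) :
    ∃ G, HasSupport (‖p.mat‖ ^ 2 / (p.lam * n ^ 2) + p.γ / n) (p.fullSmooth x) G := by
  have := ((hasSupport_inner (p.gradSimple x)).add (hasSupport_quadratic
    (‖p.mat‖ ^ 2 / (p.lam * n ^ 2)) x)).add (hasSupport_quadratic (p.γ / n) 0)
  rw [zero_add] at this
  exact ⟨_, this⟩

theorem existsUnique_fullModel (hn : 0 < n) (hp : p.Regular) (x : EuclideanSpace ℝ (Fin n)) :
    ∃! u, IsMinimizer (p.fullModel x) u := by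
  have hγ := hp.γ_pos
  have hl := hp.lam_pos
  obtain ⟨G, hG⟩ := hasSupport_fullSmooth (p := p) x
  rw [fullModel_eq hn hp]
  refine existsUnique_isMinimizer_add (by positivity) hG ?_ (properClosedConvex_psiSum hn hp)
  unfold fullSmooth
  fun_prop

end ERM

/-! ### The proximal full gradient step and the primal-dual gap -/

namespace ERM

variable {n d : ℕ} {p : ERM n d}

/-- Quadratic growth of the model at its minimizer. The borrowed terms (γ/2n)‖·‖² cancel on each
side, but the growth term keeps the γ/n. -/
theorem proxStep_spec (hn : 0 < n) (hp : p.Regular) (x : EuclideanSpace ℝ (Fin n)) :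
    (∀ i, p.proxStep x i ∈ p.dom i) ∧ ∀ u : EuclideanSpace ℝ (Fin n), (∀ i, u i ∈ p.dom i) →
      inner ℝ (p.gradSimple x) (p.proxStep x)
        + ‖p.mat‖ ^ 2 / (p.lam * n ^ 2) / 2 * ‖p.proxStep x - x‖ ^ 2
        + 1 / n * ∑ i, p.conjR i (p.proxStep x i)
        + (‖p.mat‖ ^ 2 / (p.lam * n ^ 2) + p.γ / n) / 2 * ‖u - p.proxStep x‖ ^ 2 ≤
      inner ℝ (p.gradSimple x) u + ‖p.mat‖ ^ 2 / (p.lam * n ^ 2) / 2 * ‖u - x‖ ^ 2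
        + 1 / n * ∑ i, p.conjR i (u i) := by
  have hmin : IsMinimizer (p.fullModel x) (p.proxStep x) :=
    Classical.epsilon_spec (existsUnique_fullModel hn hp x).exists
  rw [fullModel_eq hn hp] at hmin
  have hΦ := properClosedConvex_psiSum hn hp
  obtain ⟨r, hr⟩ := hmin.coe_add_finite hΦ
  have hdom := mem_dom_of_psiSum hn hp hr
  refine ⟨hdom, fun u hu => ?_⟩
  obtain ⟨G, hG⟩ := hasSupport_fullSmooth (p := p) x
  have := hmin.growth_add hG hΦ.convex (psiSum_of_mem hdom) (psiSum_of_mem hu)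
  rw [fullSmooth, fullSmooth, sum_psiR, sum_psiR, sub_zero, sub_zero] at this
  have e : p.γ / n / 2 = p.γ / (2 * n) := by rw [div_div, mul_comm (n : ℝ)]
  rw [e] at this
  linarith

theorem toReal_dual (hp : p.Regular) {x : EuclideanSpace ℝ (Fin n)} (hx : ∀ i, x i ∈ p.dom i) :
    (p.dual x).toReal = -(1 / n * ∑ i, p.conjR i (x i)) - p.fSimple x := by
  rw [dual_of_mem hp hx, EReal.toReal_coe]

theorem norm_gradSimple_sub_le (hn : 0 < n) (hp : p.Regular) (x y : EuclideanSpace ℝ (Fin n)) :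
    ‖p.gradSimple x - p.gradSimple y‖ ≤ ‖p.mat‖ ^ 2 / (p.lam * n ^ 2) * ‖x - y‖ := by
  have hl := hp.lam_pos
  have hn' : (0 : ℝ) < n := by positivity
  rw [gradSimple, gradSimple, ← smul_sub, ← map_sub, norm_smul, Real.norm_of_nonneg (by positivity)]
  calc 1 / (n : ℝ) * ‖ContinuousLinearMap.adjoint p.mat
        (conjMax p.g (p.scaled x) - conjMax p.g (p.scaled y))‖
      ≤ 1 / n * (‖p.mat‖ * ‖p.scaled x - p.scaled y‖) := by
        gcongr
        refine (ContinuousLinearMap.le_opNorm _ _).trans ?_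
        rw [LinearIsometryEquiv.norm_map]
        gcongr
        exact norm_conjMax_sub_le hp.g_strong _ _
    _ ≤ 1 / n * (‖p.mat‖ * (1 / (p.lam * n) * (‖p.mat‖ * ‖x - y‖))) := by
        gcongr
        rw [scaled_sub, norm_smul, Real.norm_of_nonneg (by positivity)]
        gcongr
        exact p.mat.le_opNorm _
    _ = _ := by
        field_simp

theorem inner_eq_gradSimple (hn : 0 < n) (y : EuclideanSpace ℝ (Fin n)) (i : Fin n) :
    inner ℝ (p.A i) (conjMax p.g (p.scaled y)) = n * p.gradSimple y i := by
  have hn' : (n : ℝ) ≠ 0 := by positivity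
  rw [gradSimple_apply]
  field_simp

/-- The primal-dual gap is a sum of Fenchel gaps of the losses. -/
theorem gap_eq (hn : 0 < n) (hp : p.Regular) {T : EuclideanSpace ℝ (Fin n)}
    (hT : ∀ i, T i ∈ p.dom i) :
    p.primal (p.omega T) - (p.dual T).toReal =
      1 / n * ∑ i, (p.φ i (n * p.gradSimple T i) + p.conjR i (T i)
        + T i * (n * p.gradSimple T i)) := by
  have hl := hp.lam_pos
  have hn' : (0 : ℝ) < n := by positivity
  have hF : p.gConj (p.scaled T) =
      inner ℝ (conjMax p.g (p.scaled T)) (p.scaled T) - p.g (conjMax p.g (p.scaled T)) :=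
    toReal_convexConj hp.g_strong _
  have hI : p.lam * inner ℝ (conjMax p.g (p.scaled T)) (p.scaled T) =
      1 / n * ∑ i, T i * (n * p.gradSimple T i) := by
    simp_rw [← inner_eq_gradSimple hn]
    conv_lhs => rw [show p.scaled T = (1 / (p.lam * n)) • p.mat T from rfl]
    rw [real_inner_smul_right, mat_apply, inner_sum]
    simp_rw [real_inner_smul_right]
    rw [← mul_assoc]
    congr 1
    · field_simp
    · refine Finset.sum_congr rfl fun i _ => ?_
      rw [real_inner_comm, ← mat_apply]
      rfl
  rw [toReal_dual hp hT, primal, omega_eq hp, fSimple, hF]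
  simp_rw [inner_eq_gradSimple hn, Finset.sum_add_distrib]
  rw [mul_sub, hI]
  ring

/-- Optimality of T in coordinate i gives equality in Fenchel–Young at `a`, so the gap at `b` is
φ(b) - φ(a) - φ'(a)(b - a), which smoothness bounds by (b - a)²/(2γ). -/
theorem fenchel_gap_le (hn : 0 < n) (hp : p.Regular) (x : EuclideanSpace ℝ (Fin n)) (i : Fin n) :
    p.φ i (n * p.gradSimple (p.proxStep x) i) + p.conjR i (p.proxStep x i)
        + p.proxStep x i * (n * p.gradSimple (p.proxStep x) i) ≤
      n ^ 2 / (2 * p.γ) * ((p.gradSimple (p.proxStep x) - p.gradSimple x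
        - (‖p.mat‖ ^ 2 / (p.lam * n ^ 2)) • (p.proxStep x - x)) i) ^ 2 := by
  have hγ := hp.γ_pos
  have hn' : (0 : ℝ) < n := by positivity
  obtain ⟨hdom, hgrow⟩ := proxStep_spec hn hp x
  set T := p.proxStep x with hT
  set K := ‖p.mat‖ ^ 2 / (p.lam * n ^ 2) with hK
  set a : ℝ := n * (p.gradSimple x i + K * (T i - x i)) with ha
  set b : ℝ := n * p.gradSimple T i with hb
  obtain ⟨hs, hsv⟩ := neg_deriv_mem_dom hp i a
  set s := deriv (p.φ i) a with hs_def
  -- The competitor replaces T_i by -φ_i'(a), the value that the optimality condition predicts.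
  set u : EuclideanSpace ℝ (Fin n) := T + EuclideanSpace.single i (-s - T i) with hu
  have hui : ∀ j, u j = if j = i then -s else T j := by
    intro j
    by_cases hj : j = i
    · subst hj; simp [hu]
    · simp [hu, hj]
  have hudom : ∀ j, u j ∈ p.dom j := by
    intro j
    rw [hui]
    split_ifs with h
    · subst h; exact hs
    · exact hdom j
  have h1 := hgrow u hudom
  have e1 : inner ℝ (p.gradSimple x) u =
      inner ℝ (p.gradSimple x) T + p.gradSimple x i * (-s - T i) := by
    rw [hu, inner_add_right, EuclideanSpace.inner_single_right]
    simp [mul_comm]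
  have e2 : ‖u - T‖ ^ 2 = (-s - T i) ^ 2 := by
    rw [hu, add_sub_cancel_left, PiLp.norm_single, Real.norm_eq_abs, sq_abs]
  have e3 : K / 2 * ‖u - x‖ ^ 2 =
      K / 2 * ‖T - x‖ ^ 2 + K * (T i - x i) * (-s - T i) + K / 2 * (-s - T i) ^ 2 := by
    rw [quadratic_expand K x T u, e2]
    congr 2
    rw [hu, add_sub_cancel_left, EuclideanSpace.inner_single_right]
    simp
    ring
  have e4 : ∑ j, p.conjR j (u j) = ∑ j, p.conjR j (T j) + (p.conjR i (-s) - p.conjR i (T i)) := by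
    rw [← sub_eq_iff_eq_add', ← Finset.sum_sub_distrib, Finset.sum_eq_single i]
    · rw [hui, if_pos rfl]
    · intro j _ hj
      rw [hui, if_neg hj, sub_self]
    · simp
  rw [e1, e2, e3, e4, hsv] at h1
  have h2 := le_conjR (hdom i) a
  have h3 : p.conjR i (T i) + p.γ / 2 * (-s - T i) ^ 2 ≤ -(a * T i) - p.φ i a := by
    have h4 : 1 / (n : ℝ) * (p.conjR i (T i)) + p.γ / n / 2 * (-s - T i) ^ 2 ≤
        (p.gradSimple x i + K * (T i - x i)) * (-s - T i) + 1 / n * (s * a - p.φ i a) := by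
      linarith
    have h5 := mul_le_mul_of_nonneg_left h4 hn'.le
    have e5 : (n : ℝ) * (1 / n * p.conjR i (T i) + p.γ / n / 2 * (-s - T i) ^ 2) =
        p.conjR i (T i) + p.γ / 2 * (-s - T i) ^ 2 := by field_simp
    have e6 : (n : ℝ) * ((p.gradSimple x i + K * (T i - x i)) * (-s - T i)
        + 1 / n * (s * a - p.φ i a)) = -(a * T i) - p.φ i a := by
      rw [mul_add, ← mul_assoc, ← mul_assoc, ← ha, mul_one_div_cancel hn'.ne']
      ring
    rwa [e5, e6] at h5
  -- Growth (`h3`) and Fenchel–Young (`h2`) are opposite inequalities up to this square, so the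
  -- prediction is correct.
  have h6 : (-s - T i) ^ 2 ≤ 0 := by nlinarith
  have h7 : T i = -s := by
    have := pow_eq_zero_iff two_ne_zero |>.1 (le_antisymm h6 (sq_nonneg _))
    linarith
  have h8 := le_of_lipschitz_deriv (hp.φ_diff i) (hp.φ_smooth i) a b
  have e7 : n ^ 2 / (2 * p.γ) * ((p.gradSimple T - p.gradSimple x - K • (T - x)) i) ^ 2 =
      1 / (2 * p.γ) * (b - a) ^ 2 := by
    rw [ha, hb]
    simp only [PiLp.sub_apply, PiLp.smul_apply, smul_eq_mul]
    ring
  rw [e7]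
  have h9 : 0 ≤ p.γ / 2 * (-s - T i) ^ 2 := by positivity
  rw [← hs_def, show s = -T i by linarith] at h8
  linarith

theorem gap_proxStep_le (hn : 0 < n) (hp : p.Regular) {x xs : EuclideanSpace ℝ (Fin n)}
    (hx : ∀ i, x i ∈ p.dom i) (hxs : p.IsDualOptimal xs) :
    p.primal (p.omega (p.proxStep x)) - (p.dual (p.proxStep x)).toReal ≤
      4 * ‖p.mat‖ ^ 2 / (p.lam * p.γ * n) * ((p.dual xs).toReal - (p.dual x).toReal) := by
  have hγ := hp.γ_pos
  have hl := hp.lam_pos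
  have hn' : (0 : ℝ) < n := by positivity
  obtain ⟨hdom, hgrow⟩ := proxStep_spec hn hp x
  have hxs_dom : ∀ i, xs i ∈ p.dom i := fun i => by
    refine mem_dom_of_dual_ne_bot hn (fun h => ?_) i
    have := hxs x
    rw [h, dual_of_mem hp hx] at this
    exact EReal.coe_ne_bot _ (le_bot_iff.1 this)
  have hopt : (p.dual (p.proxStep x)).toReal ≤ (p.dual xs).toReal := by
    have := hxs (p.proxStep x)
    rw [dual_of_mem hp hdom, dual_of_mem hp hxs_dom, EReal.coe_le_coe_iff] at this
    rwa [toReal_dual hp hdom, toReal_dual hp hxs_dom]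
  set T := p.proxStep x with hT
  set K := ‖p.mat‖ ^ 2 / (p.lam * n ^ 2) with hK
  have hK0 : 0 ≤ K := by positivity
  -- Growth of the model, tested at x itself, together with the quadratic upper bound of f₀ shows
  -- that the step raises D by at least this much.
  have hdesc : K / 2 * ‖T - x‖ ^ 2 ≤ (p.dual xs).toReal - (p.dual x).toReal := by
    have h1 := hgrow x hx
    have h2 := fSimple_upper_norm hn hp x T
    rw [toReal_dual hp hdom] at hopt
    rw [toReal_dual hp hx]
    rw [inner_sub_right] at h2
    rw [sub_self, norm_zero, norm_sub_rev x T] at h1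
    have e : ‖p.mat‖ ^ 2 / (2 * p.lam * n ^ 2) = K / 2 := by rw [hK]; field_simp
    rw [e] at h2
    have h3 : 0 ≤ p.γ / n / 2 * ‖T - x‖ ^ 2 := by positivity
    linarith
  have hnorm : ‖p.gradSimple T - p.gradSimple x - K • (T - x)‖ ≤ 2 * K * ‖T - x‖ := by
    refine (norm_sub_le _ _).trans ?_
    have := norm_gradSimple_sub_le hn hp T x
    rw [norm_smul, Real.norm_of_nonneg hK0]
    linarith
  calc p.primal (p.omega T) - (p.dual T).toReal
      = 1 / n * ∑ i, (p.φ i (n * p.gradSimple T i) + p.conjR i (T i)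
        + T i * (n * p.gradSimple T i)) := gap_eq hn hp hdom
    _ ≤ 1 / n * ∑ i, n ^ 2 / (2 * p.γ) * ((p.gradSimple T - p.gradSimple x
        - K • (T - x)) i) ^ 2 := by
        gcongr with i
        exact fenchel_gap_le hn hp x i
    _ = n / (2 * p.γ) * ‖p.gradSimple T - p.gradSimple x - K • (T - x)‖ ^ 2 := by
        rw [← Finset.mul_sum, EuclideanSpace.norm_sq_eq]
        simp only [Real.norm_eq_abs, sq_abs]
        field_simp
    _ ≤ n / (2 * p.γ) * (2 * K * ‖T - x‖) ^ 2 := by gcongr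
    _ = 4 * ‖p.mat‖ ^ 2 / (p.lam * p.γ * n) * (K / 2 * ‖T - x‖ ^ 2) := by
        have : K * (p.lam * n ^ 2) = ‖p.mat‖ ^ 2 := by rw [hK]; field_simp
        rw [← this]
        field_simp
        ring
    _ ≤ _ := by gcongr

end ERM

/-! ### The coordinate step of APCG -/

section CoordinateProx

variable {n : ℕ}

/-- The model separates. Coordinates other than j enter only through the square, so they move to its
center (1 - α)z + αy; coordinate j solves a strongly convex scalar problem, whose growth is the
three-point inequality. -/
theorem existsUnique_apcgModel (hn : 0 < n) {f : EuclideanSpace ℝ (Fin n) → ℝ}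
    {Ψ : Fin n → ℝ → EReal} {L : Fin n → ℝ} {α : ℝ} (hα : 0 < α) (hL : ∀ i, 0 < L i)
    {j : Fin n} (hΨ : ProperClosedConvex (Ψ j)) (y z : EuclideanSpace ℝ (Fin n)) :
    ∃ t r : ℝ, Ψ j t = r ∧
      (∀ s b : ℝ, Ψ j s = b →
        n * α * L j / 2 * (t - ((1 - α) * z j + α * y j)) ^ 2 + gradient f y j * (t - y j) + r
          + n * α * L j / 2 * (s - t) ^ 2 ≤
        n * α * L j / 2 * (s - ((1 - α) * z j + α * y j)) ^ 2
          + gradient f y j * (s - y j) + b) ∧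
      ∀ u, IsMinimizer (apcgModel f Ψ L α j y z) u ↔
        u = WithLp.toLp 2 (Function.update (fun i => (1 - α) * z i + α * y i) j t) := by
  have hn' : (0 : ℝ) < n := by positivity
  set c : Fin n → ℝ := fun i => (1 - α) * z i + α * y i with hc
  set G := gradient f y j with hG
  have hM : 0 < n * α * L j := by have := hL j; positivity
  set q : ℝ → ℝ := fun t => n * α * L j / 2 * ‖t - c j‖ ^ 2 + (inner ℝ G t + -(G * y j)) with hq
  have hconst : HasSupport 0 (fun _ : ℝ => -(G * y j)) fun _ => 0 := by intro a b; simp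
  have hsupp := (hasSupport_quadratic (n * α * L j) (c j)).add
    ((hasSupport_inner G).add hconst)
  rw [add_zero, add_zero] at hsupp
  have hqv : ∀ t, q t = n * α * L j / 2 * (t - c j) ^ 2 + G * (t - y j) := by
    intro t
    simp only [hq, Real.norm_eq_abs, sq_abs, RCLike.inner_apply, conj_trivial]
    ring
  have hqc : Continuous q := by fun_prop
  obtain ⟨t, ht, huniq⟩ := existsUnique_isMinimizer_add hM hsupp hqc hΨ
  obtain ⟨r, hr⟩ := ht.coe_add_finite hΨ
  refine ⟨t, r, hr, fun s b hb => ?_, ?_⟩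
  · have := ht.growth_add hsupp hΨ.convex hr hb
    change q t + r + _ ≤ q s + b at this
    rw [hqv, hqv, Real.norm_eq_abs, sq_abs] at this
    linarith
  set rest : EuclideanSpace ℝ (Fin n) → ℝ := fun u =>
    n * α / 2 * ∑ i ∈ Finset.univ.erase j, L i * (u i - c i) ^ 2 with hrest
  have hmodel : ∀ u, apcgModel f Ψ L α j y z u =
      (rest u : EReal) + ((q (u j) : EReal) + Ψ j (u j)) := by
    intro u
    rw [apcgModel, ← add_assoc, ← EReal.coe_add]
    congr 2
    rw [hqv, sqNormL, ← Finset.add_sum_erase _ _ (Finset.mem_univ j), hrest]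
    have e : ∀ i, (u - (1 - α) • z - α • y) i = u i - c i := by
      intro i
      simp only [hc, PiLp.sub_apply, PiLp.smul_apply, smul_eq_mul]
      ring
    simp only [e]
    ring
  have hterm : ∀ (u : EuclideanSpace ℝ (Fin n)) i, 0 ≤ L i * (u i - c i) ^ 2 := fun u i => by
    have := hL i
    positivity
  have hrest0 : ∀ u, 0 ≤ rest u := fun u =>
    mul_nonneg (by positivity) (Finset.sum_nonneg fun i _ => hterm u i)
  set v : EuclideanSpace ℝ (Fin n) := WithLp.toLp 2 (Function.update c j t) with hv
  have hvj : v j = t := by simp [hv]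
  have hvi : ∀ i, i ≠ j → v i = c i := fun i hi => by simp [hv, hi]
  have hrestv : rest v = 0 := by
    simp only [hrest]
    rw [Finset.sum_eq_zero, mul_zero]
    intro i hi
    rw [hvi i (Finset.ne_of_mem_erase hi)]
    simp
  have hmv : apcgModel f Ψ L α j y z v = ((q t + r : ℝ) : EReal) := by
    rw [hmodel, hrestv, hvj, hr, EReal.coe_zero, zero_add]
    exact (EReal.coe_add (q t) r).symm
  have hlow : ∀ s, ((q t + r : ℝ) : EReal) ≤ (q s : EReal) + Ψ j s := by
    intro s
    have := ht s
    simp only [hr] at this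
    rw [EReal.coe_add]
    exact this
  have hvmin : IsMinimizer (apcgModel f Ψ L α j y z) v := by
    intro u
    rw [hmv, hmodel]
    refine (hlow (u j)).trans ?_
    conv_lhs => rw [← zero_add ((q (u j) : EReal) + Ψ j (u j))]
    gcongr
    exact EReal.coe_nonneg.2 (hrest0 u)
  intro u
  refine ⟨fun hu => ?_, fun hu => hu ▸ hvmin⟩
  have h1 := hu v
  rw [hmv, hmodel, EReal.coe_add_le_coe_iff] at h1
  have h2 := (hlow (u j)).trans h1
  rw [EReal.coe_le_coe_iff] at h2
  have h3 : rest u = 0 := le_antisymm (by linarith) (hrest0 u)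
  rw [h3, sub_zero] at h1
  have huj : u j = t := huniq _ fun s => h1.trans (hlow s)
  have hsum : ∑ i ∈ Finset.univ.erase j, L i * (u i - c i) ^ 2 = 0 := by
    rcases mul_eq_zero.1 h3 with h | h
    · have : 0 < n * α / 2 := by positivity
      exact absurd h this.ne'
    · exact h
  ext i
  by_cases hi : i = j
  · rw [hi, huj, hvj]
  · rw [hvi i hi]
    have h4 := (Finset.sum_eq_zero_iff_of_nonneg fun i _ => hterm u i).1 hsum i (by simp [hi])
    have h5 := (mul_eq_zero.1 h4).resolve_left (hL i).ne'
    have h6 := pow_eq_zero_iff two_ne_zero |>.1 h5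
    linarith

end CoordinateProx

/-- The convex function `h` on `S` is the supremum of the affine functions `t ↦ a ζ * t + b ζ`,
and it is finite exactly on `S`. -/
def IsAffineSup (S : Set ℝ) (h : ℝ → ℝ) (a b : ℝ → ℝ) : Prop :=
  ∀ t c, (t ∈ S ∧ h t ≤ c) ↔ ∀ ζ, a ζ * t + b ζ ≤ c

/-- One coordinate of an APCG iterate `x` is an (implicit) convex combination of `z` and earlier
points, and `ψ` is the corresponding convex combination of the values of `h`. -/
def SurrogateInv (S : Set ℝ) (h a b : ℝ → ℝ) (s x z ψ : ℝ) : Prop :=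
  z ∈ S ∧ ∀ ζ, (a ζ * x + b ζ) - s * (a ζ * z + b ζ) ≤ ψ - s * h z

/-! ### Surrogate values and the scalar decrease inequality -/

section Scalar

variable {S : Set ℝ} {h a b : ℝ → ℝ}

theorem IsAffineSup.affine_le (hA : IsAffineSup S h a b) {t : ℝ} (ht : t ∈ S) (ζ : ℝ) :
    a ζ * t + b ζ ≤ h t :=
  (hA t (h t)).1 ⟨ht, le_rfl⟩ ζ

theorem IsAffineSup.convex (hA : IsAffineSup S h a b) {u v c₁ c₂ θ : ℝ} (h0 : 0 ≤ θ) (h1 : θ ≤ 1)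
    (hu : u ∈ S ∧ h u ≤ c₁) (hv : v ∈ S ∧ h v ≤ c₂) :
    ((1 - θ) * u + θ * v) ∈ S ∧ h ((1 - θ) * u + θ * v) ≤ (1 - θ) * c₁ + θ * c₂ := by
  rw [hA] at hu hv ⊢
  intro ζ
  linear_combination mul_le_mul_of_nonneg_left (hu ζ) (sub_nonneg.2 h1) +
    mul_le_mul_of_nonneg_left (hv ζ) h0

theorem SurrogateInv.le (hA : IsAffineSup S h a b) {s x z ψ : ℝ} (hs : 0 ≤ s)
    (hI : SurrogateInv S h a b s x z ψ) : x ∈ S ∧ h x ≤ ψ := by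
  rw [hA]
  intro ζ
  linear_combination hI.2 ζ + mul_le_mul_of_nonneg_left (hA.affine_le hI.1 ζ) hs

theorem surrogateInv_init (hA : IsAffineSup S h a b) {s x : ℝ} (hs : s ≤ 1) (hx : x ∈ S) :
    SurrogateInv S h a b s x x (h x) := by
  refine ⟨hx, fun ζ => ?_⟩
  linear_combination mul_le_mul_of_nonneg_left (hA.affine_le hx ζ) (sub_nonneg.2 hs)

/-- The new x is an affine combination of x, z and z' in which z has a nonpositive coefficient, so
h(x) ≤ ψ alone would not propagate. The invariant also records that x - nαz leaves enough weight on
z to absorb it. -/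
theorem SurrogateInv.step (hA : IsAffineSup S h a b) {n α x z z' y ψ : ℝ} (hn : 1 ≤ n)
    (hα : 0 < α) (hs : n * α ≤ 1) (hI : SurrogateInv S h a b (n * α) x z ψ) (hz' : z' ∈ S)
    (hy : y = 1 / (1 + α) * (x + α * z)) :
    SurrogateInv S h a b (n * α) (y + n * α * (z' - z) + n * α ^ 2 * (z - y)) z'
      ((1 - n * α ^ 2) / (1 + α) * ψ + α * (1 - n) / (1 + α) * h z + n * α * h z') := by
  refine ⟨hz', fun ζ => ?_⟩
  have hα1 : α ≤ 1 := by nlinarith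
  have hcx : 0 ≤ (1 - n * α ^ 2) / (1 + α) := by
    refine div_nonneg ?_ (by linarith)
    nlinarith
  -- Net weight of z after extracting the multiple of x - nαz; its sign is where nα ≤ 1 is decisive.
  have hcz : 0 ≤ (1 - n * α ^ 2) / (1 + α) * (n * α) + α * (1 - n) / (1 + α) := by
    have : (1 - n * α ^ 2) / (1 + α) * (n * α) + α * (1 - n) / (1 + α) =
        α * (1 - (n * α) ^ 2) / (1 + α) := by ring
    rw [this]
    refine div_nonneg (mul_nonneg hα.le ?_) (by linarith)
    nlinarith [mul_nonneg (by linarith : (0 : ℝ) ≤ n) hα.le]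
  have hx' : y + n * α * (z' - z) + n * α ^ 2 * (z - y) =
      (1 - n * α ^ 2) / (1 + α) * x + α * (1 - n) / (1 + α) * z + n * α * z' := by
    rw [hy]
    field_simp
    ring
  have hone : (1 - n * α ^ 2) / (1 + α) + α * (1 - n) / (1 + α) + n * α = 1 := by
    field_simp
    ring
  rw [hx']
  have e : b ζ = ((1 - n * α ^ 2) / (1 + α) + α * (1 - n) / (1 + α) + n * α) * b ζ := by
    rw [hone, one_mul]
  have h1 := mul_le_mul_of_nonneg_left (hI.2 ζ) hcx
  have h2 := mul_le_mul_of_nonneg_left (hA.affine_le hI.1 ζ) hcz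
  linear_combination h1 + h2 + e

/-- The contribution of one coordinate, summed over the n draws: it is updated to `t` once and
placed at the center n - 1 times. The three-point inequality, weighted by nα, supplies the progress.
Convexity of h at the center and at y bounds the n - 1 idle terms, and the result cancels exactly
against the negative coefficient of `hz` and the deficit in that of ψ. -/
theorem coordinate_decrease {n α L G x z y ψ t u hz hc hy ht hu : ℝ} (hn : 1 ≤ n) (hα : 0 < α)
    (hα1 : α ≤ 1) (hL : 0 ≤ L) (hyx : (1 + α) * y = x + α * z)
    (h1 : hc ≤ (1 - α) * hz + α * hy) (h2 : (1 + α) * hy ≤ ψ + α * hz)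
    (hprox : n * α * L / 2 * (t - ((1 - α) * z + α * y)) ^ 2 + G * (t - y) + ht
        + n * α * L / 2 * (u - t) ^ 2 ≤
      n * α * L / 2 * (u - ((1 - α) * z + α * y)) ^ 2 + G * (u - y) + hu) :
    G * (n * α * (t - ((1 - α) * z + α * y)))
        + L / 2 * (n * α * (t - ((1 - α) * z + α * y))) ^ 2
        + (n * ((1 - n * α ^ 2) / (1 + α) * ψ + α * (1 - n) / (1 + α) * hz)
          + n * α * (ht + (n - 1) * hc))
        + (n * α) ^ 2 / 2 * (L * ((t - u) ^ 2 + (n - 1) * ((1 - α) * z + α * y - u) ^ 2)) ≤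
      n * ((1 - α) * (ψ + (n * α) ^ 2 / 2 * (L * (z - u) ^ 2) + G * (x - y))
        + α * (G * (u - y) + hu + (n * α) ^ 2 / 2 * (L * (u - y) ^ 2))) := by
  obtain rfl : x = (1 + α) * y - α * z := by linarith
  set D := (n - 1) * α / (1 + α) with hD
  have hD0 : 0 ≤ D := div_nonneg (mul_nonneg (by linarith) hα.le) (by linarith)
  have hD1 : (n - 1) * α = D * (1 + α) := by rw [hD]; field_simp
  have e1 : (1 - n * α ^ 2) / (1 + α) = (1 - α) - α * D := by rw [hD]; field_simp; ring
  have e2 : α * (1 - n) / (1 + α) = -D := by rw [hD]; field_simp; ring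
  have hn0 : 0 ≤ n := by linarith
  have p1 := mul_le_mul_of_nonneg_left hprox (mul_nonneg hn0 hα.le)
  have p2 := mul_le_mul_of_nonneg_left h1
    (mul_nonneg hn0 (mul_nonneg hD0 (by linarith : 0 ≤ 1 + α)))
  have p3 := mul_le_mul_of_nonneg_left h2 (mul_nonneg hn0 (mul_nonneg hD0 hα.le))
  have sq : ((1 - α) * z + α * y - u) ^ 2 ≤ (1 - α) * (z - u) ^ 2 + α * (y - u) ^ 2 := by
    have : 0 ≤ α * (1 - α) * (z - y) ^ 2 :=
      mul_nonneg (mul_nonneg hα.le (by linarith)) (sq_nonneg _)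
    linear_combination this
  have p4 := mul_le_mul_of_nonneg_left sq
    (by positivity : 0 ≤ n * ((n * α) ^ 2 / 2 * L))
  rw [e1, e2]
  linear_combination p1 + p2 + p3 + p4 + n * hc * hD1

end Scalar

/-! ### Expected decrease in one APCG step -/

section OneStep

variable {n : ℕ}

theorem sum_sum_ite {n : ℕ} (A B : Fin n → ℝ) :
    ∑ j, ∑ i, (if i = j then A i else B i) = ∑ i, (A i + (n - 1) * B i) := by
  rw [Finset.sum_comm]
  refine Finset.sum_congr rfl fun i _ => ?_
  have : ∀ j, (if i = j then A i else B i) = (if i = j then A i - B i else 0) + B i := by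
    intro j
    split_ifs <;> ring
  simp_rw [this, Finset.sum_add_distrib, Finset.sum_ite_eq, Finset.mem_univ, if_true,
    Finset.sum_const, Finset.card_univ, Fintype.card_fin, nsmul_eq_mul]
  ring

theorem apcg_expected_decrease (hn : 0 < n) {α : ℝ} (hα : 0 < α) (hs : n * α ≤ 1)
    {L : Fin n → ℝ} (hL : ∀ i, 0 ≤ L i) {S : Fin n → Set ℝ} {h : Fin n → ℝ → ℝ}
    {a b : Fin n → ℝ → ℝ} (hA : ∀ i, IsAffineSup (S i) (h i) (a i) (b i))
    {f : EuclideanSpace ℝ (Fin n) → ℝ} {G : EuclideanSpace ℝ (Fin n) → EuclideanSpace ℝ (Fin n)}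
    (hlow : ∀ y x, f y + inner ℝ (G y) (x - y) + (n * α) ^ 2 / 2 * sqNormL L (x - y) ≤ f x)
    (hupp : ∀ y i t, f (y + EuclideanSpace.single i t) ≤ f y + G y i * t + L i / 2 * t ^ 2)
    {u x z y : EuclideanSpace ℝ (Fin n)} {ψ : Fin n → ℝ}
    (hI : ∀ i, SurrogateInv (S i) (h i) (a i) (b i) (n * α) (x i) (z i) (ψ i))
    (hy : y = apcgY α x z) {t : Fin n → ℝ}
    (hprox : ∀ i, n * α * L i / 2 * (t i - ((1 - α) * z i + α * y i)) ^ 2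
        + G y i * (t i - y i) + h i (t i) + n * α * L i / 2 * (u i - t i) ^ 2 ≤
      n * α * L i / 2 * (u i - ((1 - α) * z i + α * y i)) ^ 2 + G y i * (u i - y i) + h i (u i))
    {z' : Fin n → EuclideanSpace ℝ (Fin n)}
    (hz' : ∀ j i, z' j i = if i = j then t i else (1 - α) * z i + α * y i) :
    ∑ j, (f (y + (n * α) • (z' j - z) + (n * α ^ 2) • (z - y))
        + ∑ i, ((1 - n * α ^ 2) / (1 + α) * ψ i + α * (1 - n) / (1 + α) * h i (z i)
          + n * α * h i (z' j i))
        - (f u + ∑ i, h i (u i)) + (n * α) ^ 2 / 2 * sqNormL L (z' j - u)) ≤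
      n * ((1 - α) * (f x + ∑ i, ψ i - (f u + ∑ i, h i (u i))
        + (n * α) ^ 2 / 2 * sqNormL L (z - u))) := by
  have hn1 : (1 : ℝ) ≤ n := by exact_mod_cast hn
  have hα1 : α ≤ 1 := by nlinarith
  have hyi : ∀ i, y i = 1 / (1 + α) * (x i + α * z i) := fun i => by
    simp [hy, apcgY, mul_add]
  have hyx : ∀ i, (1 + α) * y i = x i + α * z i := fun i => by
    rw [hyi]
    field_simp
  have hx : ∀ i, x i ∈ S i ∧ h i (x i) ≤ ψ i := fun i => (hI i).le (hA i) (by positivity)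
  have hyS : ∀ i, y i ∈ S i ∧ (1 + α) * h i (y i) ≤ ψ i + α * h i (z i) := by
    intro i
    have h0 : 0 ≤ α / (1 + α) := by positivity
    have h1 : α / (1 + α) ≤ 1 := by rw [div_le_one (by linarith)]; linarith
    have h2 := (hA i).convex h0 h1 (hx i) ⟨(hI i).1, le_rfl⟩
    have e : (1 - α / (1 + α)) * x i + α / (1 + α) * z i = y i := by
      rw [hyi]
      field_simp
      ring
    rw [e] at h2
    refine ⟨h2.1, ?_⟩
    have h3 := mul_le_mul_of_nonneg_left h2.2 (by linarith : 0 ≤ 1 + α)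
    refine h3.trans (le_of_eq ?_)
    field_simp
    ring
  have hc : ∀ i, h i ((1 - α) * z i + α * y i) ≤ (1 - α) * h i (z i) + α * h i (y i) :=
    fun i => ((hA i).convex hα.le hα1 ⟨(hI i).1, le_rfl⟩ ⟨(hyS i).1, le_rfl⟩).2
  have hcoord := fun i => coordinate_decrease hn1 hα hα1 (hL i) (hyx i) (hc i) (hyS i).2 (hprox i)
  have hsum := Finset.sum_le_sum fun i (_ : i ∈ Finset.univ) => hcoord i
  have hf : ∀ j, f (y + (n * α) • (z' j - z) + (n * α ^ 2) • (z - y)) ≤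
      f y + (G y j * (n * α * (t j - ((1 - α) * z j + α * y j)))
        + L j / 2 * (n * α * (t j - ((1 - α) * z j + α * y j))) ^ 2) := by
    intro j
    -- The step is y + nα(z' - center), so x and y differ only in the drawn coordinate and the
    -- coordinatewise smoothness bound applies.
    have e : y + (n * α) • (z' j - z) + (n * α ^ 2) • (z - y) =
        y + EuclideanSpace.single j (n * α * (t j - ((1 - α) * z j + α * y j))) := by
      ext i
      by_cases hij : i = j
      · subst hij
        simp [hz']
        ring
      · simp [hz', hij]
        ring
    rw [e]
    have := hupp y j (n * α * (t j - ((1 - α) * z j + α * y j)))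
    linarith
  have hfs := Finset.sum_le_sum fun j (_ : j ∈ Finset.univ) => hf j
  have hψ : ∑ j, ∑ i, ((1 - n * α ^ 2) / (1 + α) * ψ i + α * (1 - n) / (1 + α) * h i (z i)
      + n * α * h i (z' j i)) =
      ∑ i, (n * ((1 - n * α ^ 2) / (1 + α) * ψ i + α * (1 - n) / (1 + α) * h i (z i))
        + n * α * (h i (t i) + (n - 1) * h i ((1 - α) * z i + α * y i))) := by
    have : ∀ j i, h i (z' j i) =
        if i = j then h i (t i) else h i ((1 - α) * z i + α * y i) := by
      intro j i
      rw [hz']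
      split_ifs <;> rfl
    simp_rw [this]
    simp_rw [Finset.sum_add_distrib (f := fun i => (1 - n * α ^ 2) / (1 + α) * ψ i
      + α * (1 - n) / (1 + α) * h i (z i)), Finset.sum_add_distrib (s := Finset.univ (α := Fin n))
      (f := fun _ : Fin n => ∑ i, ((1 - n * α ^ 2) / (1 + α) * ψ i
      + α * (1 - n) / (1 + α) * h i (z i))), ← Finset.mul_sum, sum_sum_ite]
    simp [Finset.sum_add_distrib, Finset.mul_sum, mul_add]
  have hq : ∑ j, sqNormL L (z' j - u) =
      ∑ i, L i * ((t i - u i) ^ 2 + (n - 1) * ((1 - α) * z i + α * y i - u i) ^ 2) := by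
    have : ∀ j i, L i * (z' j - u) i ^ 2 = if i = j then L i * (t i - u i) ^ 2
        else L i * ((1 - α) * z i + α * y i - u i) ^ 2 := by
      intro j i
      rw [PiLp.sub_apply, hz']
      split_ifs <;> rfl
    simp_rw [sqNormL, this, sum_sum_ite]
    exact Finset.sum_congr rfl fun i _ => by ring
  -- Strong convexity at x and at u, with weights 1 - α and α. The square at u pays for the (u - y)²
  -- left by `coordinate_decrease`; the one at x is discarded.
  have hl1 := mul_le_mul_of_nonneg_left (hlow y x)
    (mul_nonneg (by linarith : (0 : ℝ) ≤ n) (by linarith : 0 ≤ 1 - α))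
  have hl2 := mul_le_mul_of_nonneg_left (hlow y u)
    (mul_nonneg (by linarith : (0 : ℝ) ≤ n) hα.le)
  have hsq : 0 ≤ n * (1 - α) * ((n * α) ^ 2 / 2 * sqNormL L (x - y)) := by
    have : 0 ≤ sqNormL L (x - y) := Finset.sum_nonneg fun i _ => mul_nonneg (hL i) (sq_nonneg _)
    have : 0 ≤ 1 - α := by linarith
    positivity
  have hinner : ∀ v, inner ℝ (G y) (v - y) = ∑ i, G y i * (v i - y i) := by
    intro v
    simp [PiLp.inner_apply, mul_comm]
  have hsq' : ∀ v w : EuclideanSpace ℝ (Fin n),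
      sqNormL L (v - w) = ∑ i, L i * (v i - w i) ^ 2 := fun v w => rfl
  rw [hinner] at hl1 hl2
  rw [hsq' u y] at hl2
  rw [hsq' z u]
  simp only [Finset.sum_add_distrib, ← Finset.mul_sum] at hsum hfs hψ
  simp only [Finset.sum_add_distrib, Finset.sum_sub_distrib, ← Finset.mul_sum, Finset.sum_const,
    Finset.card_univ, Fintype.card_fin, nsmul_eq_mul] at hfs hsum hψ ⊢
  rw [hq]
  linarith

end OneStep

/-! ### Expectations along a randomly driven trajectory -/

section RandomTrajectory

variable {S ι : Type*}

/-- The trajectory of a system driven by the inputs `ξ 0, ξ 1, …`. -/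
def trajectory (step : S → ι → S) (s₀ : S) (ξ : ℕ → ι) : ℕ → S
  | 0 => s₀
  | k + 1 => step (trajectory step s₀ ξ k) (ξ k)

theorem trajectory_congr (step : S → ι → S) (s₀ : S) {ξ ξ' : ℕ → ι} {k : ℕ}
    (h : ∀ m < k, ξ m = ξ' m) : trajectory step s₀ ξ k = trajectory step s₀ ξ' k := by
  induction k with
  | zero => rfl
  | succ k ih =>
    rw [trajectory, trajectory, ih fun m hm => h m (by omega), h k (by omega)]

theorem trajectory_invariant {step : S → ι → S} {s₀ : S} {P : S → Prop} (h₀ : P s₀)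
    (hP : ∀ s j, P s → P (step s j)) (ξ : ℕ → ι) (k : ℕ) : P (trajectory step s₀ ξ k) := by
  induction k with
  | zero => exact h₀
  | succ k ih => exact hP _ _ ih

/-- The state at time k depends on the first k inputs only. When ι is finite these form a finite
type, so every real function of the state is measurable and bounded, whatever `step` is; no
measurable selection of minimizers is needed. -/
theorem exists_trajectory_factor [Nonempty ι] (step : S → ι → S) (s₀ : S) (k : ℕ) :
    ∃ T : (Finset.range k → ι) → S, ∀ ξ : ℕ → ι, trajectory step s₀ ξ k = T fun m => ξ m := by
  classical
  refine ⟨fun c => trajectory step s₀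
    (fun m => if hm : m ∈ Finset.range k then c ⟨m, hm⟩ else Classical.arbitrary ι) k, fun ξ => ?_⟩
  refine trajectory_congr step s₀ fun m hm => ?_
  simp [hm]

variable [Fintype ι] [Nonempty ι] [MeasurableSpace ι] [MeasurableSingletonClass ι]
  {Ω : Type*} [MeasurableSpace Ω] {Pr : Measure Ω} [IsProbabilityMeasure Pr] {i : ℕ → Ω → ι}

theorem integrable_trajectory (hi : ∀ k, Measurable (i k)) (step : S → ι → S) (s₀ : S)
    (V : S → ℝ) (k : ℕ) :
    Integrable (fun ω => V (trajectory step s₀ (fun m => i m ω) k)) Pr := by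
  obtain ⟨T, hT⟩ := exists_trajectory_factor step s₀ k
  simp_rw [hT]
  have hmeas : Measurable fun ω => V (T fun m => i m ω) := by
    have h1 : Measurable fun c : Finset.range k → ι => V (T c) := measurable_of_finite _
    exact h1.comp (measurable_pi_lambda _ fun m => hi m)
  obtain ⟨C, hC⟩ := (Set.finite_range fun c : Finset.range k → ι => ‖V (T c)‖).bddAbove
  exact Integrable.of_bound hmeas.aestronglyMeasurable C
    (Filter.Eventually.of_forall fun ω => hC ⟨_, rfl⟩)

/-- Split over the value of the input at time k; its indicator is independent of the state at time
k, which is a function of the earlier inputs. -/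
theorem integral_trajectory_succ (hi : ∀ k, Measurable (i k)) (hind : iIndepFun i Pr)
    {q : ℝ} (hq : ∀ k j, Pr.real {ω | i k ω = j} = q) (step : S → ι → S) (s₀ : S)
    (V : S → ℝ) (k : ℕ) :
    ∫ ω, V (trajectory step s₀ (fun m => i m ω) (k + 1)) ∂Pr =
      ∫ ω, q * ∑ j, V (step (trajectory step s₀ (fun m => i m ω) k) j) ∂Pr := by
  classical
  have hint : ∀ j, Integrable
      (fun ω => V (step (trajectory step s₀ (fun m => i m ω) k) j)) Pr := fun j =>
    integrable_trajectory hi step s₀ (fun s => V (step s j)) k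
  have hset : ∀ j, MeasurableSet {ω | i k ω = j} := fun j => hi k (measurableSet_singleton j)
  have hsplit : ∀ ω, V (trajectory step s₀ (fun m => i m ω) (k + 1)) =
      ∑ j, V (step (trajectory step s₀ (fun m => i m ω) k) j) *
        {ω | i k ω = j}.indicator (fun _ => (1 : ℝ)) ω := by
    intro ω
    rw [trajectory, Finset.sum_eq_single (i k ω)]
    · simp
    · intro j _ hj
      simp [hj.symm]
    · simp
  have hprod : ∀ j, ∫ ω, V (step (trajectory step s₀ (fun m => i m ω) k) j) *
      {ω | i k ω = j}.indicator (fun _ => (1 : ℝ)) ω ∂Pr =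
      q * ∫ ω, V (step (trajectory step s₀ (fun m => i m ω) k) j) ∂Pr := by
    intro j
    obtain ⟨T, hT⟩ := exists_trajectory_factor step s₀ k
    have hI := (hind.indepFun_finset (Finset.range k) {k} (by simp) hi).comp
      (φ := fun c => V (step (T c) j))
      (ψ := fun c => ({j} : Set ι).indicator (fun _ => (1 : ℝ)) (c ⟨k, by simp⟩))
      (measurable_of_finite _) (measurable_of_finite _)
    have hX : (fun ω => V (step (trajectory step s₀ (fun m => i m ω) k) j)) =
        (fun c => V (step (T c) j)) ∘ fun ω (m : Finset.range k) => i m ω := by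
      funext ω
      simp [hT]
    have hY : (fun ω => {ω | i k ω = j}.indicator (fun _ => (1 : ℝ)) ω) =
        (fun c : ({k} : Finset ℕ) → ι => ({j} : Set ι).indicator (fun _ => (1 : ℝ))
          (c ⟨k, by simp⟩)) ∘ fun ω (m : ({k} : Finset ℕ)) => i m ω := by
      funext ω
      simp [Set.indicator]
    rw [← hX, ← hY] at hI
    rw [hI.integral_fun_mul_eq_mul_integral (hint j).aestronglyMeasurable
      ((measurable_const.indicator (hset j)).aestronglyMeasurable), mul_comm,
      integral_indicator_const _ (hset j), hq, smul_eq_mul, mul_one]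
  simp_rw [hsplit]
  rw [integral_finsetSum _ fun j _ => ?_, integral_const_mul,
    integral_finsetSum _ fun j _ => hint j, Finset.mul_sum]
  · exact Finset.sum_congr rfl fun j _ => hprod j
  · refine ((hint j).indicator (hset j)).congr (Filter.Eventually.of_forall fun ω => ?_)
    by_cases h : i k ω = j <;> simp [h]

/-- A geometric decrease in expectation at every step, for a potential `V`. -/
theorem integral_trajectory_le (hi : ∀ k, Measurable (i k)) (hind : iIndepFun i Pr)
    {q : ℝ} (hq : ∀ k j, Pr.real {ω | i k ω = j} = q) {step : S → ι → S} {s₀ : S}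
    {P : S → Prop} (h₀ : P s₀) (hP : ∀ s j, P s → P (step s j)) {V : S → ℝ} {ρ : ℝ} (hρ : 0 ≤ ρ)
    (hV : ∀ s, P s → q * ∑ j, V (step s j) ≤ ρ * V s) (k : ℕ) :
    ∫ ω, V (trajectory step s₀ (fun m => i m ω) k) ∂Pr ≤ ρ ^ k * V s₀ := by
  induction k with
  | zero => simp [trajectory]
  | succ k ih =>
    rw [integral_trajectory_succ hi hind hq]
    calc ∫ ω, q * ∑ j, V (step (trajectory step s₀ (fun m => i m ω) k) j) ∂Pr
        ≤ ∫ ω, ρ * V (trajectory step s₀ (fun m => i m ω) k) ∂Pr :=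
          integral_mono
            (integrable_trajectory hi step s₀ (fun s => q * ∑ j, V (step s j)) k)
            (integrable_trajectory hi step s₀ (fun s => ρ * V s) k)
            fun ω => hV _ (trajectory_invariant h₀ hP _ k)
      _ = ρ * ∫ ω, V (trajectory step s₀ (fun m => i m ω) k) ∂Pr := integral_const_mul _ _
      _ ≤ ρ * (ρ ^ k * V s₀) := by gcongr
      _ = ρ ^ (k + 1) * V s₀ := by ring

end RandomTrajectory

/-- Uses 1 - α ≤ exp(-α). If B = 0 the product vanishes, and if log B ≤ 0 any k works; otherwise Nα
≥ 1 turns the hypothesis into log B ≤ kα. -/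
theorem pow_mul_le_one_of_log_le {α N B : ℝ} (hα : 0 < α) (hα1 : α ≤ 1) (hN : 1 ≤ N * α)
    (hB : 0 ≤ B) {k : ℕ} (hk : N * Real.log B ≤ k) : (1 - α) ^ k * B ≤ 1 := by
  rcases hB.eq_or_lt with rfl | hB
  · simp
  have hlog : Real.log B ≤ k * α := by
    rcases le_or_gt (Real.log B) 0 with h | h
    · exact h.trans (by positivity)
    · have h1 := mul_le_mul_of_nonneg_right hk hα.le
      nlinarith
  have h1 : (1 - α) ^ k ≤ Real.exp (-(k * α)) := by
    have h2 : 1 - α ≤ Real.exp (-α) := by linarith [Real.add_one_le_exp (-α)]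
    calc (1 - α) ^ k ≤ Real.exp (-α) ^ k := by gcongr
      _ = Real.exp (-(k * α)) := by rw [← Real.exp_nat_mul, mul_neg]
  have h3 : B ≤ Real.exp (k * α) := by
    rw [← Real.log_le_iff_le_exp hB]
    exact hlog
  calc (1 - α) ^ k * B ≤ Real.exp (-(k * α)) * Real.exp (k * α) := by gcongr
    _ = 1 := by rw [← Real.exp_add, neg_add_cancel, Real.exp_zero]

/-! ### APCG on the dual problem -/

namespace ERM

variable {n d : ℕ} {p : ERM n d} {R : ℝ}

theorem isAffineSup (hn : 0 < n) (hp : p.Regular) (i : Fin n) :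
    IsAffineSup (p.dom i) (p.psiR i) (fun z => -(1 / n * (z - p.γ * deriv (p.φ i) z)))
      (fun z => 1 / n * (p.γ / 2 * deriv (p.φ i) z ^ 2 - p.φ i z)) := by
  intro t c
  rw [← ΨSplit_le_iff hn hp]
  constructor
  · rintro ⟨ht, hc⟩
    rw [ΨSplit_of_mem ht]
    exact EReal.coe_le_coe_iff.2 hc
  · intro h
    have ht := mem_dom_of_ΨSplit_le hn h
    rw [ΨSplit_of_mem ht, EReal.coe_le_coe_iff] at h
    exact ⟨ht, h⟩

theorem Lip_pos (hn : 0 < n) (hp : p.Regular) (i : Fin n) : 0 < p.Lip i := by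
  have hγ := hp.γ_pos
  have hl := hp.lam_pos
  unfold Lip
  positivity

theorem mu_pos (hn : 0 < n) (hp : p.Regular) : 0 < p.mu R := by
  have hγ := hp.γ_pos
  have hl := hp.lam_pos
  unfold mu
  positivity

theorem mu_le_one (hn : 0 < n) (hp : p.Regular) : p.mu R ≤ 1 := by
  have hγ := hp.γ_pos
  have hl := hp.lam_pos
  unfold mu
  rw [div_le_one (by positivity)]
  nlinarith [sq_nonneg R]

/-- This is what makes the (γ/n)-strong convexity of f in the Euclidean norm a μ-strong convexity in
‖·‖_L. -/
theorem mu_mul_Lip_le (hn : 0 < n) (hp : p.Regular) (hR : ∀ i, ‖p.A i‖ ≤ R) (i : Fin n) :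
    p.mu R * p.Lip i ≤ p.γ / n := by
  have hγ := hp.γ_pos
  have hl := hp.lam_pos
  have hn' : (0 : ℝ) < n := by positivity
  have h1 : ‖p.A i‖ ^ 2 ≤ R ^ 2 := pow_le_pow_left₀ (norm_nonneg _) (hR i) 2
  have h2 : p.Lip i ≤ (R ^ 2 + p.lam * p.γ * n) / (p.lam * n ^ 2) := by
    have : (R ^ 2 + p.lam * p.γ * n) / (p.lam * n ^ 2) = R ^ 2 / (p.lam * n ^ 2) + p.γ / n := by
      field_simp
    rw [this, Lip]
    gcongr
  refine (mul_le_mul_of_nonneg_left h2 (mu_pos hn hp).le).trans (le_of_eq ?_)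
  have : R ^ 2 + p.lam * p.γ * n ≠ 0 := by positivity
  rw [mu]
  field_simp

theorem mu_mul_sqNormL_le (hn : 0 < n) (hp : p.Regular) (hR : ∀ i, ‖p.A i‖ ≤ R)
    (v : EuclideanSpace ℝ (Fin n)) : p.mu R / 2 * sqNormL p.Lip v ≤ p.γ / n / 2 * ‖v‖ ^ 2 := by
  rw [sqNormL, EuclideanSpace.norm_sq_eq, Finset.mul_sum, Finset.mul_sum]
  refine Finset.sum_le_sum fun i _ => ?_
  have := mul_le_mul_of_nonneg_right (mu_mul_Lip_le hn hp hR i) (sq_nonneg (v i))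
  rw [Real.norm_eq_abs, sq_abs]
  linarith

/-- After squaring and dropping the cross term, it suffices that (n² + nR²/(λγ))μ = n², an identity
by the choice of μ. -/
theorem one_le_rate_mul (hn : 0 < n) (hp : p.Regular) :
    1 ≤ (n + √(n * R ^ 2 / (p.lam * p.γ))) * (√(p.mu R) / n) := by
  have hγ := hp.γ_pos
  have hl := hp.lam_pos
  have hn' : (0 : ℝ) < n := by positivity
  rw [← mul_div_assoc, one_le_div hn']
  refine (pow_le_pow_iff_left₀ hn'.le (by positivity) two_ne_zero).1 ?_
  rw [mul_pow, Real.sq_sqrt (mu_pos hn hp).le]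
  have h1 : n ^ 2 + n * R ^ 2 / (p.lam * p.γ) ≤ (n + √(n * R ^ 2 / (p.lam * p.γ))) ^ 2 := by
    rw [add_sq, Real.sq_sqrt (by positivity)]
    have : 0 ≤ 2 * n * √(n * R ^ 2 / (p.lam * p.γ)) := by positivity
    linarith
  refine le_trans (le_of_eq ?_) (mul_le_mul_of_nonneg_right h1 (mu_pos hn hp).le)
  have : R ^ 2 + p.lam * p.γ * n ≠ 0 := by positivity
  rw [mu]
  field_simp
  ring

/-- One step of APCG, together with the surrogate values of `Ψ_i` at `x`. -/
noncomputable def apcgStep (p : ERM n d) (α : ℝ)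
    (s : EuclideanSpace ℝ (Fin n) × EuclideanSpace ℝ (Fin n) × (Fin n → ℝ)) (j : Fin n) :
    EuclideanSpace ℝ (Fin n) × EuclideanSpace ℝ (Fin n) × (Fin n → ℝ) :=
  let y := apcgY α s.1 s.2.1
  let z' := argminOf (apcgModel p.fSplit p.ΨSplit p.Lip α j y s.2.1)
  (y + (n * α) • (z' - s.2.1) + (n * α ^ 2) • (s.2.1 - y), z', fun i =>
    (1 - n * α ^ 2) / (1 + α) * s.2.2 i + α * (1 - n) / (1 + α) * p.psiR i (s.2.1 i)
      + n * α * p.psiR i (z' i))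

/-- The potential that APCG decreases in expectation. -/
noncomputable def potential (p : ERM n d) (α : ℝ) (xs : EuclideanSpace ℝ (Fin n))
    (s : EuclideanSpace ℝ (Fin n) × EuclideanSpace ℝ (Fin n) × (Fin n → ℝ)) : ℝ :=
  p.fSplit s.1 + ∑ i, s.2.2 i - (p.fSplit xs + ∑ i, p.psiR i (xs i))
    + (n * α) ^ 2 / 2 * sqNormL p.Lip (s.2.1 - xs)

/-- The invariant of the iterates of APCG. -/
def StateInv (p : ERM n d) (α : ℝ)
    (s : EuclideanSpace ℝ (Fin n) × EuclideanSpace ℝ (Fin n) × (Fin n → ℝ)) : Prop :=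
  ∀ i, SurrogateInv (p.dom i) (p.psiR i) (fun z => -(1 / n * (z - p.γ * deriv (p.φ i) z)))
    (fun z => 1 / n * (p.γ / 2 * deriv (p.φ i) z ^ 2 - p.φ i z)) (n * α) (s.1 i) (s.2.1 i)
    (s.2.2 i)

/-- The surrogates are carried along without influencing x and z. -/
theorem apcg_eq_trajectory (x0 : EuclideanSpace ℝ (Fin n)) (ξ : ℕ → Fin n) (k : ℕ) :
    apcg p.fSplit p.ΨSplit p.Lip (p.mu R) x0 ξ k =
      ((trajectory (p.apcgStep (√(p.mu R) / n)) (x0, x0, fun i => p.psiR i (x0 i)) ξ k).1,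
        (trajectory (p.apcgStep (√(p.mu R) / n)) (x0, x0, fun i => p.psiR i (x0 i)) ξ k).2.1) := by
  induction k with
  | zero => rfl
  | succ k ih =>
    rw [apcg, ih]
    rfl

theorem existsUnique_minimizer_apcg (hn : 0 < n) (hp : p.Regular) {α : ℝ} (hα : 0 < α)
    (j : Fin n) (y z : EuclideanSpace ℝ (Fin n)) :
    ∃! u, IsMinimizer (apcgModel p.fSplit p.ΨSplit p.Lip α j y z) u := by
  obtain ⟨t, r, -, -, h⟩ := existsUnique_apcgModel hn hα (Lip_pos hn hp)
    (properClosedConvex_ΨSplit hn hp j) (f := p.fSplit) y z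
  exact ⟨_, (h _).2 rfl, fun u hu => (h u).1 hu⟩

/-- The coordinate step of APCG: existence of the coordinate minimizers, the three point
inequality, and the shape of the minimizer of the model. -/
theorem exists_coordinate_prox (hn : 0 < n) (hp : p.Regular) {α : ℝ} (hα : 0 < α)
    (y z : EuclideanSpace ℝ (Fin n)) (j : Fin n) :
    ∃ t ∈ p.dom j,
      (∀ s ∈ p.dom j,
        n * α * p.Lip j / 2 * (t - ((1 - α) * z j + α * y j)) ^ 2 + p.gradSplit y j * (t - y j)
          + p.psiR j t + n * α * p.Lip j / 2 * (s - t) ^ 2 ≤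
        n * α * p.Lip j / 2 * (s - ((1 - α) * z j + α * y j)) ^ 2
          + p.gradSplit y j * (s - y j) + p.psiR j s) ∧
      ∀ i, argminOf (apcgModel p.fSplit p.ΨSplit p.Lip α j y z) i =
        if i = j then t else (1 - α) * z i + α * y i := by
  obtain ⟨t, r, hr, hgrow, hmin⟩ := existsUnique_apcgModel hn hα (Lip_pos hn hp)
    (properClosedConvex_ΨSplit hn hp j) (f := p.fSplit) y z
  have ht := mem_dom_of_ΨSplit_le hn hr.le
  have hr' : p.psiR j t = r := by
    rw [ΨSplit_of_mem ht] at hr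
    exact EReal.coe_injective hr
  rw [(hasGradientAt_fSplit hn hp y).gradient] at hgrow
  refine ⟨t, ht, fun s hs => ?_, fun i => ?_⟩
  · rw [hr']
    exact hgrow s _ (ΨSplit_of_mem hs)
  · rw [argminOf_eq (existsUnique_minimizer_apcg hn hp hα j y z) ((hmin _).2 rfl)]
    simp [Function.update_apply]

theorem apcgY_apply (α : ℝ) (x z : EuclideanSpace ℝ (Fin n)) (i : Fin n) :
    apcgY α x z i = 1 / (1 + α) * (x i + α * z i) := by
  simp [apcgY, mul_add]

theorem StateInv.mem_dom_le (hn : 0 < n) (hp : p.Regular) {α : ℝ} (hα : 0 < α)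
    {s : EuclideanSpace ℝ (Fin n) × EuclideanSpace ℝ (Fin n) × (Fin n → ℝ)}
    (hs : p.StateInv α s) (i : Fin n) : s.1 i ∈ p.dom i ∧ p.psiR i (s.1 i) ≤ s.2.2 i :=
  (hs i).le (isAffineSup hn hp i) (by positivity)

theorem StateInv.step (hn : 0 < n) (hp : p.Regular) {α : ℝ} (hα : 0 < α) (hα1 : n * α ≤ 1)
    {s : EuclideanSpace ℝ (Fin n) × EuclideanSpace ℝ (Fin n) × (Fin n → ℝ)}
    (hs : p.StateInv α s) (j : Fin n) : p.StateInv α (p.apcgStep α s j) := by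
  have hn1 : (1 : ℝ) ≤ n := by exact_mod_cast hn
  have hαle : α ≤ 1 := by nlinarith
  obtain ⟨x, z, ψ⟩ := s
  obtain ⟨t, ht, -, hz'⟩ := exists_coordinate_prox hn hp hα (apcgY α x z) z j
  intro i
  have hA := isAffineSup hn hp i
  refine (hs i).step hA hn1 hα hα1 ?_ (apcgY_apply α x z i)
  change argminOf (apcgModel p.fSplit p.ΨSplit p.Lip α j (apcgY α x z) z) i ∈ p.dom i
  rw [hz']
  split_ifs with hij
  · exact hij ▸ ht
  · have hy := (hA.convex (θ := α / (1 + α)) (by positivity)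
      (by rw [div_le_one (by linarith)]; linarith) ((hs i).le hA (by positivity))
      ⟨(hs i).1, le_rfl⟩).1
    have e : (1 - α / (1 + α)) * x i + α / (1 + α) * z i = apcgY α x z i := by
      rw [apcgY_apply]
      field_simp
      ring
    simp only [e] at hy
    exact (hA.convex hα.le hαle ⟨(hs i).1, le_rfl⟩ ⟨hy, le_rfl⟩).1

theorem potential_decrease (hn : 0 < n) (hp : p.Regular) (hR : ∀ i, ‖p.A i‖ ≤ R) {α : ℝ}
    (hα : α = √(p.mu R) / n) {xs : EuclideanSpace ℝ (Fin n)} (hxs : ∀ i, xs i ∈ p.dom i)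
    {s : EuclideanSpace ℝ (Fin n) × EuclideanSpace ℝ (Fin n) × (Fin n → ℝ)}
    (hs : p.StateInv α s) :
    1 / n * ∑ j, p.potential α xs (p.apcgStep α s j) ≤ (1 - α) * p.potential α xs s := by
  have hn' : (0 : ℝ) < n := by positivity
  have hμ : 0 < p.mu R := mu_pos hn hp
  have hα0 : 0 < α := by rw [hα]; positivity
  have hnα : n * α = √(p.mu R) := by rw [hα]; field_simp
  have hnα1 : n * α ≤ 1 := by
    rw [hnα]
    exact (Real.sqrt_le_sqrt (mu_le_one hn hp)).trans_eq Real.sqrt_one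
  have hsq : (n * α) ^ 2 = p.mu R := by rw [hnα, Real.sq_sqrt hμ.le]
  obtain ⟨x, z, ψ⟩ := s
  choose t ht hgrow hz' using exists_coordinate_prox hn hp hα0 (apcgY α x z) z
  have hlow : ∀ y x, p.fSplit y + inner ℝ (p.gradSplit y) (x - y)
      + (n * α) ^ 2 / 2 * sqNormL p.Lip (x - y) ≤ p.fSplit x := fun y x => by
    have h1 := hasSupport_fSplit hn hp y x
    have h2 := mu_mul_sqNormL_le hn hp hR (x - y)
    rw [hsq]
    linarith
  have hz'' : ∀ j i, argminOf (apcgModel p.fSplit p.ΨSplit p.Lip α j (apcgY α x z) z) i =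
      if i = j then t i else (1 - α) * z i + α * apcgY α x z i := fun j i => by
    rw [hz']
    split_ifs with h
    · rw [h]
    · rfl
  have key := apcg_expected_decrease hn hα0 hnα1 (fun i => (Lip_pos hn hp i).le)
    (isAffineSup hn hp) hlow (fSplit_upper_single hn hp) hs rfl (fun i => hgrow i _ (hxs i)) hz''
  rw [one_div, inv_mul_le_iff₀ hn']
  exact key

theorem dual_gap_le_potential (hn : 0 < n) (hp : p.Regular) {α : ℝ} (hα : 0 < α)
    {xs : EuclideanSpace ℝ (Fin n)} (hxs : ∀ i, xs i ∈ p.dom i)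
    {s : EuclideanSpace ℝ (Fin n) × EuclideanSpace ℝ (Fin n) × (Fin n → ℝ)}
    (hs : p.StateInv α s) :
    (p.dual xs).toReal - (p.dual s.1).toReal ≤ p.potential α xs s := by
  have hx := fun i => hs.mem_dom_le hn hp hα i
  have h1 := Finset.sum_le_sum fun i (_ : i ∈ Finset.univ) => (hx i).2
  have h2 : 0 ≤ (n * α) ^ 2 / 2 * sqNormL p.Lip (s.2.1 - xs) :=
    mul_nonneg (by positivity)
      (Finset.sum_nonneg fun i _ => mul_nonneg (Lip_pos hn hp i).le (sq_nonneg _))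
  rw [dual_eq_neg hn hp, dual_eq_neg hn hp, psiSum_of_mem hxs, psiSum_of_mem fun i => (hx i).1,
    ← EReal.coe_add, ← EReal.coe_add, ← EReal.coe_neg, ← EReal.coe_neg, EReal.toReal_coe,
    EReal.toReal_coe, potential]
  linarith

/-- At the start the surrogates are exact, and (μ/2)‖·‖_L² ≤ (γ/2n)‖·‖² produces the quadratic term
of C. -/
theorem potential_init_le (hn : 0 < n) (hp : p.Regular) (hR : ∀ i, ‖p.A i‖ ≤ R) {α : ℝ}
    (hα : α = √(p.mu R) / n) {xs x0 : EuclideanSpace ℝ (Fin n)} (hxs : ∀ i, xs i ∈ p.dom i)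
    (hx0 : ∀ i, x0 i ∈ p.dom i) :
    p.potential α xs (x0, x0, fun i => p.psiR i (x0 i)) ≤ p.constC x0 xs := by
  have hn' : (0 : ℝ) < n := by positivity
  have hsq : (n * α) ^ 2 = p.mu R := by
    rw [hα, mul_div_cancel₀ _ hn'.ne', Real.sq_sqrt (mu_pos hn hp).le]
  have h := mu_mul_sqNormL_le hn hp hR (x0 - xs)
  have e : p.γ / n / 2 = p.γ / (2 * n) := by rw [div_div, mul_comm (n : ℝ)]
  rw [e] at h
  rw [constC, dual_eq_neg hn hp, dual_eq_neg hn hp, psiSum_of_mem hxs, psiSum_of_mem hx0,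
    ← EReal.coe_add, ← EReal.coe_add, ← EReal.coe_neg, ← EReal.coe_neg, EReal.toReal_coe,
    EReal.toReal_coe, potential, hsq]
  linarith

end ERM

theorem corollary2 {n d : ℕ} (hn : 0 < n) (p : ERM n d) (hp : p.Regular)
    (R : ℝ) (hR : ∀ i, ‖p.A i‖ ≤ R)
    (x0 : EuclideanSpace ℝ (Fin n)) (hx0 : p.dual x0 ≠ ⊥)
    (ε : ℝ) (hε : 0 < ε)
    {Ω : Type*} [MeasurableSpace Ω] (Pr : Measure Ω) [IsProbabilityMeasure Pr]
    (i : ℕ → Ω → Fin n) (hi_meas : ∀ k, Measurable (i k))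
    (hi_unif : ∀ k j, Pr.real {ω | i k ω = j} = 1 / n)
    (hi_indep : iIndepFun i Pr) :
    -- the conjugate `g^*` is finite and differentiable, and all maximizers and minimizers below
    -- exist and are unique
    (∀ v, convexConj p.g v = (p.gConj v : EReal)) ∧ Differentiable ℝ p.gConj ∧
    (∃! xs, p.IsDualOptimal xs) ∧
    (∀ j y z, ∃! u, IsMinimizer
      (apcgModel p.fSplit p.ΨSplit p.Lip (√(p.mu R) / n) j y z) u) ∧
    (∀ x, ∃! u, IsMinimizer (p.fullModel x) u) ∧
    -- the expected primal-dual gap after `k` steps and one proximal full gradient step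
    ∀ xs, p.IsDualOptimal xs → ∀ k : ℕ,
      (k : ℝ) ≥ (n + √(n * R ^ 2 / (p.lam * p.γ))) *
        Real.log (4 * ‖p.mat‖ ^ 2 / (p.lam * p.γ * n) * (p.constC x0 xs / ε)) →
      let T : Ω → EuclideanSpace ℝ (Fin n) :=
        fun ω => p.proxStep (p.iter R x0 (fun m => i m ω) k)
      let w : Ω → EuclideanSpace ℝ (Fin d) := fun ω => p.omega (T ω)
      (∀ ω, p.dual (T ω) ≠ ⊥ ∧ p.dual (T ω) ≠ ⊤) ∧
      Integrable (fun ω => p.primal (w ω) - (p.dual (T ω)).toReal) Pr ∧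
      ∫ ω, (p.primal (w ω) - (p.dual (T ω)).toReal) ∂Pr ≤ ε := by
  have hl := hp.lam_pos
  have hγ := hp.γ_pos
  have hn' : (0 : ℝ) < n := by positivity
  have hn1 : (1 : ℝ) ≤ n := by exact_mod_cast hn
  have : Nonempty (Fin n) := ⟨⟨0, hn⟩⟩
  have hμ : 0 < p.mu R := ERM.mu_pos hn hp
  obtain ⟨α, hα⟩ : ∃ α, α = √(p.mu R) / n := ⟨_, rfl⟩
  have hα0 : 0 < α := by rw [hα]; positivity
  have hnα : n * α ≤ 1 := by
    rw [hα, mul_div_cancel₀ _ hn'.ne']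
    exact (Real.sqrt_le_sqrt (ERM.mu_le_one hn hp)).trans_eq Real.sqrt_one
  have hα1 : α ≤ 1 := by nlinarith
  refine ⟨ERM.gConj_eq hp, fun v => (ERM.gConj_hasGradientAt hp v).differentiableAt,
    ERM.existsUnique_isDualOptimal hn hp,
    fun j y z => ERM.existsUnique_minimizer_apcg hn hp (hα ▸ hα0) j y z,
    ERM.existsUnique_fullModel hn hp, ?_⟩
  intro xs hxs k hk T w
  have hx0dom := ERM.mem_dom_of_dual_ne_bot hn hx0
  have hxsdom : ∀ i, xs i ∈ p.dom i := ERM.mem_dom_of_dual_ne_bot hn fun h =>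
    hx0 (le_bot_iff.1 (h ▸ hxs x0))
  set s₀ : EuclideanSpace ℝ (Fin n) × EuclideanSpace ℝ (Fin n) × (Fin n → ℝ) :=
    (x0, x0, fun i => p.psiR i (x0 i)) with hs₀
  have hInit : p.StateInv α s₀ := fun i =>
    surrogateInv_init (ERM.isAffineSup hn hp i) hnα (hx0dom i)
  have hStep : ∀ s j, p.StateInv α s → p.StateInv α (p.apcgStep α s j) :=
    fun s j hs => hs.step hn hp hα0 hnα j
  have hiter : ∀ ω, p.iter R x0 (fun m => i m ω) k =
      (trajectory (p.apcgStep α) s₀ (fun m => i m ω) k).1 := fun ω => by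
    rw [ERM.iter, ERM.apcg_eq_trajectory, ← hα]
  have hInv : ∀ ω, p.StateInv α (trajectory (p.apcgStep α) s₀ (fun m => i m ω) k) := fun ω =>
    trajectory_invariant hInit hStep _ k
  have hgap : ∀ ω, p.primal (w ω) - (p.dual (T ω)).toReal ≤
      4 * ‖p.mat‖ ^ 2 / (p.lam * p.γ * n) *
        p.potential α xs (trajectory (p.apcgStep α) s₀ (fun m => i m ω) k) := by
    intro ω
    have h1 : p.primal (w ω) - (p.dual (T ω)).toReal ≤ 4 * ‖p.mat‖ ^ 2 / (p.lam * p.γ * n) *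
        ((p.dual xs).toReal
          - (p.dual (trajectory (p.apcgStep α) s₀ (fun m => i m ω) k).1).toReal) := by
      simp only [w, T, hiter]
      exact ERM.gap_proxStep_le hn hp (fun j => ((hInv ω).mem_dom_le hn hp hα0 j).1) hxs
    refine h1.trans ?_
    gcongr
    exact ERM.dual_gap_le_potential hn hp hα0 hxsdom (hInv ω)
  have hint : Integrable (fun ω => p.primal (w ω) - (p.dual (T ω)).toReal) Pr := by
    simp only [w, T, hiter]
    exact integrable_trajectory hi_meas (p.apcgStep α) s₀
      (fun s => p.primal (p.omega (p.proxStep s.1)) - (p.dual (p.proxStep s.1)).toReal) k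
  have hVint := integrable_trajectory (Pr := Pr) hi_meas (p.apcgStep α) s₀
    (p.potential α xs) k
  have hV := integral_trajectory_le hi_meas hi_indep hi_unif hInit hStep
    (sub_nonneg.2 hα1) (fun s hs => ERM.potential_decrease hn hp hR hα hxsdom hs) k
  have hC := ERM.potential_init_le hn hp hR hα hxsdom hx0dom
  -- Needed so that the argument of the logarithm is nonnegative in `pow_mul_le_one_of_log_le`; its
  -- value 0 is the case AC = 0.
  have hC0 : 0 ≤ p.constC x0 xs := by
    refine le_trans ?_ ((ERM.dual_gap_le_potential hn hp hα0 hxsdom hInit).trans hC)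
    have h := hxs x0
    rw [ERM.dual_of_mem hp hx0dom, ERM.dual_of_mem hp hxsdom, EReal.coe_le_coe_iff] at h
    rw [ERM.toReal_dual hp hxsdom, ERM.toReal_dual hp hx0dom]
    exact sub_nonneg.2 h
  refine ⟨fun ω => ?_, hint, ?_⟩
  · rw [ERM.dual_of_mem hp (ERM.proxStep_spec hn hp _).1]
    exact ⟨EReal.coe_ne_bot _, EReal.coe_ne_top _⟩
  have hrate := pow_mul_le_one_of_log_le hα0 hα1 (hα ▸ ERM.one_le_rate_mul hn hp)
    (by positivity) hk
  calc ∫ ω, (p.primal (w ω) - (p.dual (T ω)).toReal) ∂Pr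
      ≤ ∫ ω, 4 * ‖p.mat‖ ^ 2 / (p.lam * p.γ * n) *
        p.potential α xs (trajectory (p.apcgStep α) s₀ (fun m => i m ω) k) ∂Pr :=
        integral_mono hint (hVint.const_mul _) hgap
    _ = 4 * ‖p.mat‖ ^ 2 / (p.lam * p.γ * n) *
        ∫ ω, p.potential α xs (trajectory (p.apcgStep α) s₀ (fun m => i m ω) k) ∂Pr :=
        integral_const_mul _ _
    _ ≤ 4 * ‖p.mat‖ ^ 2 / (p.lam * p.γ * n) * ((1 - α) ^ k * p.constC x0 xs) := by
        gcongr
        refine hV.trans ?_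
        have : 0 ≤ 1 - α := sub_nonneg.2 hα1
        gcongr
    _ = ((1 - α) ^ k * (4 * ‖p.mat‖ ^ 2 / (p.lam * p.γ * n) * (p.constC x0 xs / ε))) * ε := by
        field_simp
    _ ≤ 1 * ε := by gcongr
    _ = ε := one_mul ε
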